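/- Let $e\ge 1$ be an integer, $\epsilon=\exp(2\pi i/e)$, and let $G=G(e,e,2)\subset \mathrm{GL}_2(\mathbb C)$ be the dihedral group generated by $\rho,\sigma$, acting on $B=\mathbb C[x_1,x_2]$ by algebra automorphisms with $\rho(x_1)=\epsilon x_1$, $\rho(x_2)=\epsilon^{-1}x_2$, $\sigma(x_1)=x_2$, $\sigma(x_2)=x_1$. Let $A_2=B^G$, let $\mathcal D_B=\mathbb C\langle x_1,x_2,\partial_1,\partial_2\rangle$ be the Weyl algebra, and let $\mathcal D_2=\mathcal D_B^G$. Put $\nabla=x_1\partial_1+x_2\partial_2$, $\mathcal D_2(k)=\{P\in\mathcal D_2 : [\nabla,P]=kP\}$, $\mathcal D_2^0=\mathcal D_2(0)$ and $\mathcal D_2^-=\bigoplus_{k<0}\mathcal D_2(k)$. For a $\mathcal D_2$-submodule $M\subset B$ put $M^{ann}=\{m\in M : \mathcal D_2^-m=0\}$, a $\mathcal D_2^0$-module. Define $\mathcal D_2$-submodules of $B$ by $$M_0=\mathcal D_2\cdot 1,\qquad M_e=\mathcal D_2(x_1^e-x_2^e),\qquad M_i^1=\mathcal D_2x_1^i,\quad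 M_i^2=\mathcal D_2x_2^i\quad (1\le i<e/2),$$ and, when $e=2e_1$ is even, also $M_{e_1}^{I}=\mathcal D_2(x_1^{e_1}+x_2^{e_1})$ and $M_{e_1}^{II}=\mathcal D_2(x_1^{e_1}-x_2^{e_1})$. Below, terms containing $e_1$ occur only when $e=2e_1$ is even. Then $A_2=\mathbb C[x_1^e+x_2^e,\,x_1x_2]$, and $$M_0=A_2,\quad M_e=A_2(x_1^e-x_2^e),\quad M_i^1=A_2x_1^i+A_2x_2^{e-i},\quad M_i^2=A_2x_2^i+A_2x_1^{e-i},$$ $$M_{e_1}^{I}=A_2(x_1^{e_1}+x_2^{e_1}),\quad M_{e_1}^{II}=A_2(x_1^{e_1}-x_2^{e_1}).$$ Moreover: 1. The elements $1$, $x_1^i$, $x_2^i$ ($1\le i\le e-1$), $x_1^e-x_2^e$ form a basis of $B$ as an $A_2$-module. 2. The $\mathcal D_2$-module $B$ is the internal direct sum of simple submodules $$B=M_0\oplus M_e\oplus\bigoplus_{1\le i<e/2}(M_i^1\oplus M_i^2)\oplus M_{e_1}^{I}\oplus M_{e_1}^{II}.$$ 3. For $1\le i<e/2$ we have $M_i^1\cong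 M_i^2$ as $\mathcal D_2$-modules, and these modules have rank $2$ over $A_2$; there are no other isomorphisms between distinct members of the list in (2). If $e$ is odd, the $\mathcal D_2$-submodules of $B$ of rank $1$ over $A_2$ are exactly the (non-isomorphic) modules $M_0$ and $M_e$. If $e=2e_1$ is even, they are exactly the (pairwise non-isomorphic) modules $M_0$, $M_e$, $M_{e_1}^{I}$ and $M_{e_1}^{II}$. 4. The lowest weight spaces are $M_0^{ann}=\mathbb C\cdot 1$, $M_e^{ann}=\mathbb C(x_1^e-x_2^e)$, $(M_i^1)^{ann}=\mathbb C x_1^i$, $(M_i^2)^{ann}=\mathbb C x_2^i$ $(1\le i<e/2)$, $(M_{e_1}^{I})^{ann}=\mathbb C(x_1^{e_1}+x_2^{e_1})$ and $(M_{e_1}^{II})^{ann}=\mathbb C(x_1^{e_1}-x_2^{e_1})$. They are simple $\mathcal D_2^0$-modules, and $B^{ann}$ is their internal direct sum. Consequently $B^{ann}$ is a Gelfand model of $G$: as a representation of $G$ it is the direct sum of subrepresentations that form a complete set of representatives, without repetition, of the isomorphism classes of irreducible complex representations of $G$. -/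

import Mathlib

open MvPolynomial

noncomputable section

namespace InvDiff

/-! ### Invariant differential operators of a finite linear group -/

/-- The polynomial algebra `B = ℂ[x₁, …, xₙ] = S(V)`, where `V = ℂⁿ` has the basis `x₁, …, xₙ`. -/
abbrev Poly (n : ℕ) : Type := MvPolynomial (Fin n) ℂ

/-- The action of `GL(V)` on `B = S(V)` by algebra automorphisms, extending the canonical action
`g xⱼ = ∑ᵢ gᵢⱼ xᵢ` on `V`. -/
def polyRep (n : ℕ) : Representation ℂ (GL (Fin n) ℂ) (Poly n) where
  toFun g := (aeval (R := ℂ) fun j : Fin n =>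
    ∑ i : Fin n, C ((g : Matrix (Fin n) (Fin n) ℂ) i j) * (X i : Poly n)).toLinearMap
  map_one' := by
    have h : (aeval (R := ℂ) fun j : Fin n => ∑ i : Fin n,
        C (((1 : GL (Fin n) ℂ) : Matrix (Fin n) (Fin n) ℂ) i j) * (X i : Poly n))
        = AlgHom.id ℂ (Poly n) := by
      ext1 j
      simp [Matrix.one_apply]
    rw [h]
    rfl
  map_mul' g h := by
    have h : (aeval (R := ℂ) fun j : Fin n => ∑ i : Fin n,
        C (((g * h : GL (Fin n) ℂ) : Matrix (Fin n) (Fin n) ℂ) i j) * (X i : Poly n))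
        = (aeval (R := ℂ) fun j : Fin n => ∑ i : Fin n,
            C ((g : Matrix (Fin n) (Fin n) ℂ) i j) * (X i : Poly n)).comp
          (aeval (R := ℂ) fun j : Fin n => ∑ i : Fin n,
            C ((h : Matrix (Fin n) (Fin n) ℂ) i j) * (X i : Poly n)) := by
      ext1 j
      simp only [aeval_X, AlgHom.comp_apply, map_sum, map_mul, Units.val_mul, Matrix.mul_apply,
        algHom_C, algebraMap_eq, Finset.sum_mul, Finset.mul_sum]
      rw [Finset.sum_comm]
      refine Finset.sum_congr rfl fun k _ => Finset.sum_congr rfl fun i _ => ?_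
      ring
    rw [h]
    rfl

/-- The Weyl algebra `𝒟_B`: the algebra of operators on `B` generated by the multiplications by
the variables and the partial derivatives. -/
def weyl (n : ℕ) : Subalgebra ℂ (Module.End ℂ (Poly n)) :=
  Algebra.adjoin ℂ (Set.range (fun i : Fin n => LinearMap.mulLeft ℂ (X i : Poly n)) ∪
    Set.range (fun i : Fin n => (pderiv (R := ℂ) i).toLinearMap))

/-- The Euler operator `∇ = x₁∂₁ + ⋯ + xₙ∂ₙ`. -/
def euler (n : ℕ) : Module.End ℂ (Poly n) :=
  ∑ i : Fin n, LinearMap.mulLeft ℂ (X i : Poly n) * (pderiv (R := ℂ) i).toLinearMap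

variable {n : ℕ} (G : Subgroup (GL (Fin n) ℂ))

/-- The representation of `G ⊆ GL(V)` on `B`. -/
def rep : Representation ℂ G (Poly n) := (polyRep n).comp G.subtype

/-- The invariant ring `A = B^G`. -/
def inv : Subalgebra ℂ (Poly n) where
  carrier := {b | ∀ g : G, rep G g b = b}
  mul_mem' := by
    intro a b ha hb g
    have : rep G g (a * b) = rep G g a * rep G g b := map_mul (aeval (R := ℂ) _) a b
    rw [this, ha g, hb g]
  add_mem' := by
    intro a b ha hb g
    rw [map_add, ha g, hb g]
  algebraMap_mem' := fun r g => (aeval (R := ℂ) _).commutes r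

/-- The algebra `𝒟 = 𝒟_B^G` of invariant differential operators; `g ∈ G` acts on `𝒟_B` by
`P ↦ g P g⁻¹`. -/
def invDiffOp : Subalgebra ℂ (Module.End ℂ (Poly n)) :=
  weyl n ⊓ Subalgebra.centralizer ℂ (Set.range (rep G))

/-- The ring `𝒟 = 𝒟_B^G`, as a type. -/
def DOp : Type := invDiffOp G

instance : Ring (DOp G) := inferInstanceAs (Ring (invDiffOp G))

/-- The inclusion `𝒟 → End(B)`. -/
def DOp.toEnd : DOp G →+* Module.End ℂ (Poly n) := (invDiffOp G).val.toRingHom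

/-- `𝒟` acts on `B` by evaluating operators. -/
instance : Module (DOp G) (Poly n) := Module.compHom (Poly n) (DOp.toEnd G)

/-- The homogeneous part `𝒟(k) = {P ∈ 𝒟 | [∇, P] = k P}`. -/
def degPart (k : ℤ) : Submodule ℂ (Module.End ℂ (Poly n)) where
  carrier := {P | P ∈ invDiffOp G ∧ euler n * P - P * euler n = (k : ℂ) • P}
  zero_mem' := ⟨zero_mem _, by simp⟩
  add_mem' := by
    rintro P Q ⟨hP, hP'⟩ ⟨hQ, hQ'⟩
    refine ⟨add_mem hP hQ, ?_⟩
    rw [smul_add, ← hP', ← hQ', mul_add, add_mul]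
    abel
  smul_mem' := by
    rintro c P ⟨hP, hP'⟩
    refine ⟨(invDiffOp G).smul_mem hP c, ?_⟩
    rw [mul_smul_comm, smul_mul_assoc, ← smul_sub, hP', smul_comm]

/-- `𝒟⁻ = ⨁_{k < 0} 𝒟(k)`. -/
def negPart : Submodule ℂ (Module.End ℂ (Poly n)) :=
  ⨆ (k : ℤ) (_ : k < 0), degPart G k

/-- The algebra `𝒟⁰ = 𝒟(0)`. -/
def zeroPart : Subalgebra ℂ (Module.End ℂ (Poly n)) where
  carrier := {P | P ∈ degPart G 0}
  mul_mem' := by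
    rintro P Q ⟨hP, hP'⟩ ⟨hQ, hQ'⟩
    refine ⟨mul_mem hP hQ, ?_⟩
    simp only [Int.cast_zero, zero_smul, sub_eq_zero] at hP' hQ' ⊢
    rw [← mul_assoc, hP', mul_assoc, hQ', mul_assoc]
  add_mem' := fun hP hQ => (degPart G 0).add_mem hP hQ
  algebraMap_mem' := by
    intro r
    refine ⟨(invDiffOp G).algebraMap_mem r, ?_⟩
    rw [Algebra.commutes r (euler n)]
    simp

/-- The ring `𝒟⁰`, as a type. -/
def DOpZero : Type := zeroPart G

instance : Ring (DOpZero G) := inferInstanceAs (Ring (zeroPart G))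

/-- The inclusion `𝒟⁰ → End(B)`. -/
def DOpZero.toEnd : DOpZero G →+* Module.End ℂ (Poly n) := (zeroPart G).val.toRingHom

/-- `𝒟⁰` acts on `B` by evaluating operators. -/
instance : Module (DOpZero G) (Poly n) := Module.compHom (Poly n) (DOpZero.toEnd G)

lemma mul_mem_negPart {P Q : Module.End ℂ (Poly n)} (hP : P ∈ negPart G)
    (hQ : Q ∈ zeroPart G) : P * Q ∈ negPart G := by
  have key : negPart G ≤ (negPart G).comap (LinearMap.mulRight ℂ Q) := by
    refine iSup₂_le fun k hk R hR => ?_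
    refine (le_iSup₂_of_le (f := fun (k : ℤ) (_ : k < 0) => degPart G k) k hk le_rfl) ?_
    obtain ⟨hR, hR'⟩ := hR
    obtain ⟨hQ, hQ'⟩ := hQ
    refine ⟨mul_mem hR hQ, ?_⟩
    simp only [Int.cast_zero, zero_smul, sub_eq_zero] at hQ'
    simp only [LinearMap.mulRight_apply]
    rw [mul_assoc, ← hQ', ← mul_assoc, ← mul_assoc, ← sub_mul, hR', smul_mul_assoc]
  exact key hP

/-- Let `N ⊆ B` be a `𝒟`-submodule. Its lowest weight space
`N^ann = {b ∈ N | 𝒟⁻ b = 0}`, as a `𝒟⁰`-module. -/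
def ann (N : Submodule (DOp G) (Poly n)) : Submodule (DOpZero G) (Poly n) where
  carrier := {b | b ∈ N ∧ ∀ P ∈ negPart G, P b = 0}
  zero_mem' := ⟨zero_mem _, fun P _ => map_zero P⟩
  add_mem' := by
    rintro a b ⟨ha, ha'⟩ ⟨hb, hb'⟩
    refine ⟨add_mem ha hb, fun P hP => ?_⟩
    rw [map_add, ha' P hP, hb' P hP, add_zero]
  smul_mem' := by
    rintro ⟨Q, hQ⟩ b ⟨hb, hb'⟩
    exact ⟨N.smul_mem (⟨Q, hQ.1⟩ : DOp G) hb,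
      fun P hP => hb' (P * Q) (mul_mem_negPart G hP hQ)⟩

/-- `B^ann`, as a representation of `G`. -/
def annRep : Subrepresentation (rep G) where
  toSubmodule :=
    { carrier := ann G ⊤
      zero_mem' := zero_mem _
      add_mem' := add_mem
      smul_mem' := fun c b hb => ⟨trivial, fun P hP => by rw [map_smul, hb.2 P hP, smul_zero]⟩ }
  apply_mem_toSubmodule := by
    rintro g b ⟨-, hb⟩
    refine ⟨trivial, fun P hP => ?_⟩
    have hPD : P ∈ Subalgebra.toSubmodule (invDiffOp G) :=
      (iSup₂_le fun k _ R hR => hR.1 : negPart G ≤ Subalgebra.toSubmodule (invDiffOp G)) hP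
    have hc : rep G g * P = P * rep G g :=
      (Subalgebra.mem_centralizer_iff ℂ).1 hPD.2 _ ⟨g, rfl⟩
    have h1 : P (rep G g b) = rep G g (P b) := (LinearMap.congr_fun hc b).symm
    rw [h1, hb P hP, map_zero]

lemma mulLeft_mem_invDiffOp {a : Poly n} (ha : a ∈ inv G) :
    LinearMap.mulLeft ℂ a ∈ invDiffOp G := by
  refine ⟨?_, ?_⟩
  · have h : ∀ p : Poly n, LinearMap.mulLeft ℂ p ∈ weyl n := by
      intro p
      induction p using MvPolynomial.induction_on with
      | C c =>
        have : LinearMap.mulLeft ℂ (C c : Poly n) = algebraMap ℂ _ c := by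
          refine LinearMap.ext fun b => ?_
          simp [C_mul', Module.algebraMap_end_apply]
        rw [this]
        exact (weyl n).algebraMap_mem c
      | add p q hp hq =>
        have : LinearMap.mulLeft ℂ (p + q) = LinearMap.mulLeft ℂ p + LinearMap.mulLeft ℂ q := by
          refine LinearMap.ext fun b => ?_
          simp [add_mul]
        rw [this]
        exact add_mem hp hq
      | mul_X p i hp =>
        rw [LinearMap.mulLeft_mul]
        exact mul_mem hp (Algebra.subset_adjoin (Or.inl ⟨i, rfl⟩))
    exact h a
  · refine (Subalgebra.mem_centralizer_iff ℂ).2 ?_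
    rintro _ ⟨g, rfl⟩
    refine LinearMap.ext fun b => ?_
    have : rep G g (a * b) = rep G g a * rep G g b := map_mul (aeval (R := ℂ) _) a b
    simp only [Module.End.mul_apply, LinearMap.mulLeft_apply]
    rw [this, ha g]

/-- A `𝒟`-submodule of `B`, regarded as an `A`-submodule of `B`. -/
def asInvModule (N : Submodule (DOp G) (Poly n)) : Submodule (inv G) (Poly n) where
  carrier := N
  zero_mem' := N.zero_mem
  add_mem' := N.add_mem
  smul_mem' := fun a _ hb =>
    N.smul_mem (⟨LinearMap.mulLeft ℂ (a : Poly n), mulLeft_mem_invDiffOp G a.2⟩ : DOp G) hb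

/-- A complex representation `ρ` of a group `H` is a Gelfand model if it is the direct sum of
subrepresentations `W i`, which form a complete set of representatives of the isomorphism classes
of irreducible complex representations of `H`. (Only finite groups `H : Type` are relevant here;
their irreducible representations all occur, up to isomorphism, on spaces in `Type`.) -/
def IsGelfandModel {H U : Type} [Group H] [AddCommGroup U] [Module ℂ U]
    (ρ : Representation ℂ H U) : Prop :=
  ∃ (ι : Type) (W : ι → Subrepresentation ρ),
    (iSupIndep (fun i => (W i).toSubmodule) ∧ ⨆ i, (W i).toSubmodule = ⊤) ∧
    (∀ i, (W i).toRepresentation.IsIrreducible) ∧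
    (∀ i j, Nonempty ((W i).toRepresentation.Equiv (W j).toRepresentation) → i = j) ∧
    ∀ (T : Type) [AddCommGroup T] [Module ℂ T] (τ : Representation ℂ H T), τ.IsIrreducible →
      ∃ i, Nonempty (τ.Equiv (W i).toRepresentation)

/-! ### The dihedral group `G(e,e,2)` -/

/-- `ε = exp(2πi/e)`. -/
def eps (e : ℕ) : ℂ := Complex.exp (2 * Real.pi * Complex.I / e)

/-- The rotation `ρ`, with `ρ x₁ = ε x₁` and `ρ x₂ = ε⁻¹ x₂`. -/
def rot (e : ℕ) : GL (Fin 2) ℂ :=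
  Matrix.GeneralLinearGroup.mkOfDetNeZero !![eps e, 0; 0, (eps e)⁻¹]
    (by simp [Matrix.det_fin_two, eps])

/-- The reflection `σ`, which interchanges `x₁` and `x₂`. -/
def swap : GL (Fin 2) ℂ :=
  Matrix.GeneralLinearGroup.mkOfDetNeZero !![0, 1; 1, 0] (by simp [Matrix.det_fin_two])

/-- The dihedral group `G(e,e,2)` of order `2e`, generated by `ρ` and `σ`. -/
def dihedral (e : ℕ) : Subgroup (GL (Fin 2) ℂ) := Subgroup.closure {rot e, swap}

/-- `A₂ = B^{G(e,e,2)}`. -/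
abbrev A₂ (e : ℕ) : Subalgebra ℂ (Poly 2) := inv (dihedral e)

/-- `𝒟₂ = 𝒟_B^{G(e,e,2)}`. -/
abbrev D₂ (e : ℕ) : Type := DOp (dihedral e)

/-- `𝒟₂⁰`, the operators of degree `0` in `𝒟₂`. -/
abbrev D₂zero (e : ℕ) : Type := DOpZero (dihedral e)

/-- The variable `x₁`. -/
abbrev x₁ : Poly 2 := X 0

/-- The variable `x₂`. -/
abbrev x₂ : Poly 2 := X 1

/-- Indices of the basis of `B` over `A₂`. -/
inductive BasisIndex (e : ℕ) : Type
  | one : BasisIndex e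
  | pow₁ (i : ℕ) (hi : 1 ≤ i) (hie : i ≤ e - 1) : BasisIndex e
  | pow₂ (i : ℕ) (hi : 1 ≤ i) (hie : i ≤ e - 1) : BasisIndex e
  | jac : BasisIndex e

/-- The elements `1`, `x₁^i`, `x₂^i` (`1 ≤ i ≤ e - 1`), `x₁^e - x₂^e`. -/
def basisElt {e : ℕ} : BasisIndex e → Poly 2
  | .one => 1
  | .pow₁ i _ _ => x₁ ^ i
  | .pow₂ i _ _ => x₂ ^ i
  | .jac => x₁ ^ e - x₂ ^ e

/-- Labels of the modules `M₀`, `M_e`, `M_i¹`, `M_i²` (`1 ≤ i < e/2`), and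
`M_{e₁}^I`, `M_{e₁}^{II}` (if `e = 2e₁`). -/
inductive Label (e : ℕ) : Type
  | zero : Label e
  | jac : Label e
  | pow₁ (i : ℕ) (hi : 1 ≤ i) (hie : 2 * i < e) : Label e
  | pow₂ (i : ℕ) (hi : 1 ≤ i) (hie : 2 * i < e) : Label e
  | I (e₁ : ℕ) (he : e = 2 * e₁) : Label e
  | II (e₁ : ℕ) (he : e = 2 * e₁) : Label e

/-- The elements that generate the modules `M`. -/
def gen {e : ℕ} : Label e → Poly 2
  | .zero => 1
  | .jac => x₁ ^ e - x₂ ^ e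
  | .pow₁ i _ _ => x₁ ^ i
  | .pow₂ i _ _ => x₂ ^ i
  | .I e₁ _ => x₁ ^ e₁ + x₂ ^ e₁
  | .II e₁ _ => x₁ ^ e₁ - x₂ ^ e₁

/-- The `𝒟₂`-modules `M = 𝒟₂ · gen`. -/
def M {e : ℕ} (c : Label e) : Submodule (D₂ e) (Poly 2) := Submodule.span (D₂ e) {gen c}

/-- Generators of `M` over `A₂`. -/
def genA {e : ℕ} : Label e → Set (Poly 2)
  | .zero => {1}
  | .jac => {x₁ ^ e - x₂ ^ e}
  | .pow₁ i _ _ => {x₁ ^ i, x₂ ^ (e - i)}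
  | .pow₂ i _ _ => {x₂ ^ i, x₁ ^ (e - i)}
  | .I e₁ _ => {x₁ ^ e₁ + x₂ ^ e₁}
  | .II e₁ _ => {x₁ ^ e₁ - x₂ ^ e₁}

/-- The rank of a `𝒟₂`-submodule of `B`, as a module over `A₂`. -/
def rankA {e : ℕ} (N : Submodule (D₂ e) (Poly 2)) : Cardinal :=
  Module.rank (A₂ e) (asInvModule (dihedral e) N)

end InvDiff

end

noncomputable section

namespace InvDiff

/-! ### Monomials and coefficients in two variables -/

/-! The rotation grades `B` by weights: the monomial with exponents `a`, `b` has weight `a - b`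
modulo `e`, and the reflection sends weight `j` to `-j`. A weight class different from its negative
gives one component, the whole weight space; a class equal to its negative (`0`, and `e/2` if `e` is
even) splits into the two eigenspaces of the reflection. These are the components `isoComp c`, where
`wt` and `sg` record weight and sign. Invariant operators commute with the group, so they preserve
each component.

Everything else rests on one supply of invariant operators, `coeffOp N a b g`. Applying `∂₁^a ∂₂^b`
and then `∏ (1 - ∇/k)` over `1 ≤ k ≤ N` reads off a coefficient of any polynomial of degree at most
`N + a + b`. Multiplying by a polynomial `g` of weight `a - b` and symmetrizing under the reflection
gives an invariant operator (`coeffOp_mem`) whose value is, up to a factorial factor, `co a b f • g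
+ co b a f • σ g` (`coeffOp_eq`). On a component this can be made a nonzero multiple of any
prescribed `g` (`exists_coeffOp_eq`). Hence every nonzero element of a component generates it, which
yields simplicity and `M c = isoComp c` (`mem_M`); directness follows because weight and sign
separate the labels.

The same operators do the remaining work. An isomorphism out of `M c` transports the identity
`coeffOp N a b (gen c) (gen c) = r • gen c`, and this forces the target to be `M c` or its mirror
image (`eq_or_eq_flip_of_equiv`). A submodule containing a nonzero `f` contains either a module of
rank one or a twisted copy of a module of rank two (`exists_M_le`), which classifies the submodules
of rank one. Since `gen c` spans the lowest degree of its component, operators of negative degree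
kill it, while any element with a term of higher degree is sent by such an operator to a nonzero
multiple of `gen c` (`mem_ann_M`).

Over the invariant ring, a two-term recursion generates each weight space by `x₁^j` and `x₂^(e-j)`
(`weightSpace_le_span`), and a 2×2 determinant proportional to `x₁^e - x₂^e` gives independence. For
the Gelfand model, `gen c` and its mirror image span an irreducible representation; an arbitrary
irreducible one receives a nonzero equivariant map from one of these, built from an eigenvector of
the rotation (`exists_equiv_irrRep`). -/

/-- The exponent `(a, b)`. -/
def expo (a b : ℕ) : Fin 2 →₀ ℕ := Finsupp.single 0 a + Finsupp.single 1 b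

@[simp] lemma expo_zero (a b : ℕ) : expo a b 0 = a := by simp [expo]

@[simp] lemma expo_one (a b : ℕ) : expo a b 1 = b := by simp [expo]

lemma eq_expo (m : Fin 2 →₀ ℕ) : m = expo (m 0) (m 1) := by
  ext i
  fin_cases i <;> simp

lemma expo_inj {a b p q : ℕ} : expo a b = expo p q ↔ a = p ∧ b = q := by
  refine ⟨fun h => ⟨?_, ?_⟩, fun h => by rw [h.1, h.2]⟩
  · simpa using DFunLike.congr_fun h 0
  · simpa using DFunLike.congr_fun h 1

/-- The monomial `x₁^a x₂^b`. -/
def mon (a b : ℕ) : Poly 2 := x₁ ^ a * x₂ ^ b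

lemma mon_eq (a b : ℕ) : mon a b = monomial (expo a b) 1 := by
  rw [mon, expo, X_pow_eq_monomial, X_pow_eq_monomial, monomial_mul, one_mul]

/-- The coefficient of `x₁^a x₂^b`. -/
def co (a b : ℕ) : Poly 2 →ₗ[ℂ] ℂ := lcoeff ℂ (expo a b)

lemma co_apply (a b : ℕ) (f : Poly 2) : co a b f = coeff (expo a b) f := rfl

lemma co_mon (a b p q : ℕ) : co a b (mon p q) = if p = a ∧ q = b then 1 else 0 := by
  rw [co_apply, mon_eq, coeff_monomial]
  simp only [expo_inj]

lemma ext_co {f g : Poly 2} (h : ∀ a b, co a b f = co a b g) : f = g := by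
  ext m
  rw [eq_expo m]
  exact h _ _

lemma eq_sum_mon (f : Poly 2) : f = ∑ m ∈ f.support, co (m 0) (m 1) f • mon (m 0) (m 1) := by
  conv_lhs => rw [f.as_sum]
  refine Finset.sum_congr rfl fun m _ => ?_
  rw [co_apply, mon_eq, ← eq_expo, smul_monomial, smul_eq_mul, mul_one]

lemma mem_of_mon {U : Submodule ℂ (Poly 2)} {f : Poly 2}
    (h : ∀ a b, co a b f ≠ 0 → mon a b ∈ U) : f ∈ U := by
  rw [eq_sum_mon f]
  refine sum_mem fun m hm => U.smul_mem _ (h _ _ ?_)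
  rw [co_apply, ← eq_expo]
  exact mem_support_iff.1 hm

/-- Commutation relations between operators are verified on monomials by means of this. -/
lemma linearMap_ext_mon {V : Type*} [AddCommMonoid V] [Module ℂ V] {φ ψ : Poly 2 →ₗ[ℂ] V}
    (h : ∀ a b, φ (mon a b) = ψ (mon a b)) : φ = ψ := by
  refine LinearMap.ext fun f => ?_
  rw [eq_sum_mon f, map_sum, map_sum]
  exact Finset.sum_congr rfl fun m _ => by rw [map_smul, map_smul, h]

lemma exists_co_ne_zero {f : Poly 2} (hf : f ≠ 0) : ∃ a b, co a b f ≠ 0 := by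
  by_contra! h
  exact hf (ext_co fun a b => by rw [h, map_zero])

/-! ### The generators of the dihedral group -/

/-- The action of the rotation on `B`. -/
def rotEnd (e : ℕ) : Module.End ℂ (Poly 2) := polyRep 2 (rot e)

/-- The action of the reflection on `B`. -/
def swapEnd : Module.End ℂ (Poly 2) := polyRep 2 swap

lemma polyRep_mul (g : GL (Fin 2) ℂ) (p q : Poly 2) :
    polyRep 2 g (p * q) = polyRep 2 g p * polyRep 2 g q := map_mul (aeval (R := ℂ) _) p q

lemma polyRep_pow (g : GL (Fin 2) ℂ) (p : Poly 2) (k : ℕ) :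
    polyRep 2 g (p ^ k) = polyRep 2 g p ^ k := map_pow (aeval (R := ℂ) _) p k

lemma polyRep_X (g : GL (Fin 2) ℂ) (j : Fin 2) :
    polyRep 2 g (X j) = ∑ i, C ((g : Matrix (Fin 2) (Fin 2) ℂ) i j) * (X i : Poly 2) :=
  aeval_X _ j

lemma eps_ne_zero (e : ℕ) : eps e ≠ 0 := Complex.exp_ne_zero _

lemma eps_primitive {e : ℕ} (he : 1 ≤ e) : IsPrimitiveRoot (eps e) e :=
  Complex.isPrimitiveRoot_exp e (by omega)

lemma eps_zpow_eq_one {e : ℕ} (he : 1 ≤ e) {j : ℤ} : eps e ^ j = 1 ↔ (e : ℤ) ∣ j :=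
  (eps_primitive he).zpow_eq_one_iff_dvd j

lemma eps_zpow_eq {e : ℕ} (he : 1 ≤ e) {i j : ℤ} : eps e ^ i = eps e ^ j ↔ (e : ℤ) ∣ i - j := by
  rw [← eps_zpow_eq_one he, zpow_sub₀ (eps_ne_zero e), div_eq_one_iff_eq]
  exact zpow_ne_zero _ (eps_ne_zero e)

lemma rotEnd_mon (e a b : ℕ) : rotEnd e (mon a b) = eps e ^ ((a : ℤ) - b) • mon a b := by
  have h0 : polyRep 2 (rot e) x₁ = eps e • x₁ := by
    rw [polyRep_X]
    simp [rot, smul_eq_C_mul]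
  have h1 : polyRep 2 (rot e) x₂ = (eps e)⁻¹ • x₂ := by
    rw [polyRep_X]
    simp [rot, smul_eq_C_mul]
  rw [rotEnd, mon, polyRep_mul, polyRep_pow, polyRep_pow, h0, h1, smul_pow, smul_pow,
    smul_mul_smul_comm, zpow_sub₀ (eps_ne_zero e), zpow_natCast, zpow_natCast, inv_pow,
    div_eq_mul_inv]

lemma swapEnd_mon (a b : ℕ) : swapEnd (mon a b) = mon b a := by
  have h0 : polyRep 2 swap x₁ = x₂ := by
    rw [polyRep_X]
    simp [swap]
  have h1 : polyRep 2 swap x₂ = x₁ := by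
    rw [polyRep_X]
    simp [swap]
  rw [swapEnd, mon, polyRep_mul, polyRep_pow, polyRep_pow, h0, h1, mon, mul_comm]

lemma rotEnd_mul (e : ℕ) (p q : Poly 2) : rotEnd e (p * q) = rotEnd e p * rotEnd e q :=
  polyRep_mul _ _ _

lemma swapEnd_mul (p q : Poly 2) : swapEnd (p * q) = swapEnd p * swapEnd q :=
  polyRep_mul _ _ _

@[simp] lemma swapEnd_swapEnd (f : Poly 2) : swapEnd (swapEnd f) = f := by
  have : swapEnd * swapEnd = 1 := linearMap_ext_mon fun a b => by
    simp [swapEnd_mon]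
  exact LinearMap.congr_fun this f

lemma co_rotEnd (e a b : ℕ) (f : Poly 2) :
    co a b (rotEnd e f) = eps e ^ ((a : ℤ) - b) * co a b f := by
  have : (co a b).comp (rotEnd e) = (eps e ^ ((a : ℤ) - b)) • co a b :=
    linearMap_ext_mon fun p q => by
      simp only [LinearMap.comp_apply, rotEnd_mon, map_smul, co_mon, LinearMap.smul_apply,
        smul_eq_mul]
      split_ifs with h
      · rw [h.1, h.2]
      · simp
  exact LinearMap.congr_fun this f

lemma co_swapEnd (a b : ℕ) (f : Poly 2) : co a b (swapEnd f) = co b a f := by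
  have : (co a b).comp swapEnd = co b a := linearMap_ext_mon fun p q => by
    simp only [LinearMap.comp_apply, swapEnd_mon, co_mon, and_comm]
  exact LinearMap.congr_fun this f

lemma rot_mem (e : ℕ) : rot e ∈ dihedral e := Subgroup.subset_closure (by simp)

lemma swap_mem (e : ℕ) : swap ∈ dihedral e := Subgroup.subset_closure (by simp)

/-- A property of the elements of the dihedral group that holds for the generators and is stable
under products and inverses holds for all elements. -/
lemma dihedral_induction {e : ℕ} {p : dihedral e → Prop} (hr : p ⟨rot e, rot_mem e⟩)
    (hs : p ⟨swap, swap_mem e⟩) (h1 : p 1) (hm : ∀ g h, p g → p h → p (g * h))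
    (hi : ∀ g, p g → p g⁻¹) (g : dihedral e) : p g := by
  obtain ⟨g, hg⟩ := g
  refine Subgroup.closure_induction (p := fun x hx => p ⟨x, hx⟩) ?_ h1 ?_ ?_ hg
  · rintro x (rfl | rfl)
    · exact hr
    · exact hs
  · exact fun x y hx hy h h' => hm ⟨x, hx⟩ ⟨y, hy⟩ h h'
  · exact fun x hx h => hi ⟨x, hx⟩ h

/-- Two representations of the dihedral group are intertwined by a linear map that is compatible
with the generators. -/
lemma intertwining_of_generators {e : ℕ} {V V' : Type*} [AddCommMonoid V] [AddCommMonoid V']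
    [Module ℂ V] [Module ℂ V'] {τ : Representation ℂ (dihedral e) V}
    {τ' : Representation ℂ (dihedral e) V'} (φ : V →ₗ[ℂ] V')
    (hr : ∀ v, φ (τ ⟨rot e, rot_mem e⟩ v) = τ' ⟨rot e, rot_mem e⟩ (φ v))
    (hs : ∀ v, φ (τ ⟨swap, swap_mem e⟩ v) = τ' ⟨swap, swap_mem e⟩ (φ v)) (g : dihedral e) (v : V) :
    φ (τ g v) = τ' g (φ v) := by
  refine dihedral_induction (p := fun g => ∀ v, φ (τ g v) = τ' g (φ v)) hr hs ?_ ?_ ?_ g v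
  · simp
  · intro g h hg hh v
    simp [hg, hh]
  · intro g hg v
    have := hg (τ g⁻¹ v)
    rw [Representation.self_inv_apply] at this
    rw [this, Representation.inv_self_apply]

lemma rot_pow {e : ℕ} (he : 1 ≤ e) : rot e ^ e = 1 := by
  refine Units.ext ?_
  have h : (rot e : Matrix (Fin 2) (Fin 2) ℂ) = Matrix.diagonal ![eps e, (eps e)⁻¹] := by
    ext i j
    fin_cases i <;> fin_cases j <;> simp [rot]
  rw [Units.val_pow_eq_pow_val, h, Matrix.diagonal_pow, Units.val_one, ← Matrix.diagonal_one]
  congr 1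
  ext i
  fin_cases i <;> simp [(eps_primitive he).pow_eq_one]

lemma swap_mul_swap : swap * swap = 1 := by
  refine Units.ext ?_
  ext i j
  fin_cases i <;> fin_cases j <;> simp [swap, Matrix.mul_apply]

/-- A submodule that is stable under the generators is stable under the dihedral group. -/
lemma stable_of_generators {e : ℕ} (he : 1 ≤ e) {V : Type*} [AddCommMonoid V]
    [Module ℂ V] (τ : Representation ℂ (dihedral e) V) (U : Submodule ℂ V)
    (hr : ∀ v ∈ U, τ ⟨rot e, rot_mem e⟩ v ∈ U)
    (hs : ∀ v ∈ U, τ ⟨swap, swap_mem e⟩ v ∈ U) (g : dihedral e) (v : V) (hv : v ∈ U) :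
    τ g v ∈ U := by
  suffices h : ∀ v ∈ U, τ g v ∈ U ∧ τ g⁻¹ v ∈ U from (h v hv).1
  -- In infinite dimension, stability under an operator does not imply stability under its inverse.
  -- Both generators have finite order, so their inverses are positive powers.
  have hpow : ∀ k : ℕ, ∀ v ∈ U, τ (⟨rot e, rot_mem e⟩ ^ k) v ∈ U := by
    intro k
    induction k with
    | zero => simp
    | succ k ih =>
      intro v hv
      rw [pow_succ, map_mul]
      exact ih _ (hr v hv)
  have hrot : (⟨rot e, rot_mem e⟩ : dihedral e)⁻¹ = ⟨rot e, rot_mem e⟩ ^ (e - 1) := by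
    rw [inv_eq_iff_mul_eq_one, ← pow_succ', Nat.sub_add_cancel he]
    exact Subtype.ext (rot_pow he)
  have hswap : (⟨swap, swap_mem e⟩ : dihedral e)⁻¹ = ⟨swap, swap_mem e⟩ := by
    rw [inv_eq_iff_mul_eq_one]
    exact Subtype.ext swap_mul_swap
  refine dihedral_induction (p := fun g => ∀ v ∈ U, τ g v ∈ U ∧ τ g⁻¹ v ∈ U) ?_ ?_ ?_ ?_ ?_ g
  · intro v hv
    rw [hrot]
    exact ⟨hr v hv, hpow _ v hv⟩
  · intro v hv
    rw [hswap]
    exact ⟨hs v hv, hs v hv⟩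
  · simp
  · intro g h hg hh v hv
    rw [mul_inv_rev, map_mul, map_mul]
    exact ⟨(hg _ (hh v hv).1).1, (hh _ (hg v hv).2).2⟩
  · intro g hg v hv
    rw [inv_inv]
    exact (hg v hv).symm

lemma mem_centralizer_of_generators {e : ℕ} {P : Module.End ℂ (Poly 2)}
    (hr : ∀ f, P (rotEnd e f) = rotEnd e (P f)) (hs : ∀ f, P (swapEnd f) = swapEnd (P f)) :
    P ∈ Subalgebra.centralizer ℂ (Set.range (rep (dihedral e))) := by
  refine (Subalgebra.mem_centralizer_iff ℂ).2 ?_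
  rintro _ ⟨g, rfl⟩
  refine LinearMap.ext fun f => ?_
  exact (intertwining_of_generators (τ := rep (dihedral e)) (τ' := rep (dihedral e)) P hr hs
    g f).symm

lemma mem_inv_iff {e : ℕ} {f : Poly 2} : f ∈ A₂ e ↔ rotEnd e f = f ∧ swapEnd f = f := by
  refine ⟨fun h => ⟨h ⟨rot e, rot_mem e⟩, h ⟨swap, swap_mem e⟩⟩, fun h g => ?_⟩
  refine dihedral_induction (p := fun g => rep (dihedral e) g f = f) h.1 h.2 ?_ ?_ ?_ g
  · simp
  · intro g h hg hh
    simp [hg, hh]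
  · intro g hg
    conv_lhs => rw [← hg]
    rw [Representation.inv_self_apply]

/-! ### Weight spaces of the rotation -/

/-- The polynomials of weight `j`, spanned by the monomials `x₁^a x₂^b` with `a - b ≡ j mod e`. -/
def weightSpace (e : ℕ) (j : ℤ) : Submodule ℂ (Poly 2) where
  carrier := {f | ∀ a b : ℕ, co a b f ≠ 0 → (e : ℤ) ∣ a - b - j}
  zero_mem' := by simp
  add_mem' := by
    intro f g hf hg a b h
    rw [map_add] at h
    by_cases h0 : co a b f = 0
    · exact hg a b (by rwa [h0, zero_add] at h)
    · exact hf a b h0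
  smul_mem' := by
    intro c f hf a b h
    rw [map_smul, smul_eq_mul] at h
    exact hf a b (right_ne_zero_of_mul h)

/-- Monomials are eigenvectors of the rotation, and `eps e` has order exactly `e`, so equal
eigenvalues mean congruent weights. -/
lemma mem_weightSpace_iff {e : ℕ} (he : 1 ≤ e) {j : ℤ} {f : Poly 2} :
    f ∈ weightSpace e j ↔ rotEnd e f = eps e ^ j • f := by
  refine ⟨fun h => ext_co fun a b => ?_, fun h a b hab => ?_⟩
  · rw [co_rotEnd, map_smul, smul_eq_mul]
    by_cases h0 : co a b f = 0
    · simp [h0]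
    · rw [(eps_zpow_eq he).2 (h a b h0)]
  · have h1 := congrArg (co a b) h
    rw [co_rotEnd, map_smul, smul_eq_mul] at h1
    exact (eps_zpow_eq he).1 (mul_right_cancel₀ hab h1)

lemma mon_mem_weightSpace {e a b : ℕ} {j : ℤ} (h : (e : ℤ) ∣ a - b - j) :
    mon a b ∈ weightSpace e j := by
  intro p q hpq
  rw [co_mon] at hpq
  split_ifs at hpq with h'
  · rwa [← h'.1, ← h'.2]
  · exact absurd rfl hpq

lemma swapEnd_mem_weightSpace {e : ℕ} {j : ℤ} {f : Poly 2} (hf : f ∈ weightSpace e j) :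
    swapEnd f ∈ weightSpace e (-j) := by
  intro a b hab
  rw [co_swapEnd] at hab
  rw [show (a : ℤ) - b - -j = -(b - a - j) by ring, dvd_neg]
  exact hf b a hab

/-! ### Invariant differential operators that extract coefficients -/

lemma mon_zero_zero : mon 0 0 = 1 := by simp [mon]

/-- The derivation `∂₁`. -/
def del₁ : Module.End ℂ (Poly 2) := (pderiv (R := ℂ) (0 : Fin 2)).toLinearMap

/-- The derivation `∂₂`. -/
def del₂ : Module.End ℂ (Poly 2) := (pderiv (R := ℂ) (1 : Fin 2)).toLinearMap

lemma del₁_mon (p q : ℕ) : del₁ (mon p q) = (p : ℂ) • mon (p - 1) q := by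
  have h : pderiv (R := ℂ) (0 : Fin 2) (x₁ ^ p * x₂ ^ q) = (p : ℂ) • (x₁ ^ (p - 1) * x₂ ^ q) := by
    rw [Derivation.leibniz, pderiv_pow, pderiv_pow, pderiv_X_self, pderiv_X_of_ne (by decide),
      smul_eq_C_mul]
    simp
    ring
  exact h

lemma del₂_mon (p q : ℕ) : del₂ (mon p q) = (q : ℂ) • mon p (q - 1) := by
  have h : pderiv (R := ℂ) (1 : Fin 2) (x₁ ^ p * x₂ ^ q) = (q : ℂ) • (x₁ ^ p * x₂ ^ (q - 1)) := by
    rw [Derivation.leibniz, pderiv_pow, pderiv_pow, pderiv_X_self, pderiv_X_of_ne (by decide),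
      smul_eq_C_mul]
    simp
    ring
  exact h

lemma del₁_pow_mon (a p q : ℕ) : (del₁ ^ a) (mon p q) = (p.descFactorial a : ℂ) • mon (p - a) q := by
  induction a with
  | zero => simp
  | succ a ih =>
    rw [pow_succ', Module.End.mul_apply, ih, map_smul, del₁_mon, smul_smul,
      Nat.descFactorial_succ, Nat.sub_sub]
    push_cast
    rw [mul_comm]

lemma del₂_pow_mon (b p q : ℕ) : (del₂ ^ b) (mon p q) = (q.descFactorial b : ℂ) • mon p (q - b) := by
  induction b with
  | zero => simp
  | succ b ih =>
    rw [pow_succ', Module.End.mul_apply, ih, map_smul, del₂_mon, smul_smul,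
      Nat.descFactorial_succ, Nat.sub_sub]
    push_cast
    rw [mul_comm]

lemma euler_eq : euler 2 = LinearMap.mulLeft ℂ x₁ * del₁ + LinearMap.mulLeft ℂ x₂ * del₂ := by
  rw [euler, Fin.sum_univ_two]
  rfl

lemma euler_mon (p q : ℕ) : euler 2 (mon p q) = ((p + q : ℕ) : ℂ) • mon p q := by
  have h1 : (p : ℂ) • (x₁ * mon (p - 1) q) = (p : ℂ) • mon p q := by
    cases p with
    | zero => simp
    | succ p => rw [Nat.add_sub_cancel, mon, mon, pow_succ']; ring_nf
  have h2 : (q : ℂ) • (x₂ * mon p (q - 1)) = (q : ℂ) • mon p q := by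
    cases q with
    | zero => simp
    | succ q => rw [Nat.add_sub_cancel, mon, mon, pow_succ']; ring_nf
  rw [euler_eq, LinearMap.add_apply, Module.End.mul_apply, Module.End.mul_apply, del₁_mon,
    del₂_mon, map_smul, map_smul, LinearMap.mulLeft_apply, LinearMap.mulLeft_apply, h1, h2,
    ← add_smul, Nat.cast_add]

lemma euler_mul (p q : Poly 2) : euler 2 (p * q) = euler 2 p * q + p * euler 2 q := by
  have h1 : del₁ (p * q) = p * del₁ q + q * del₁ p := (pderiv (R := ℂ) (0 : Fin 2)).leibniz p q
  have h2 : del₂ (p * q) = p * del₂ q + q * del₂ p := (pderiv (R := ℂ) (1 : Fin 2)).leibniz p q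
  simp only [euler_eq, LinearMap.add_apply, Module.End.mul_apply, LinearMap.mulLeft_apply, h1, h2]
  ring

lemma co_euler (a b : ℕ) (f : Poly 2) : co a b (euler 2 f) = ((a + b : ℕ) : ℂ) * co a b f := by
  have : (co a b).comp (euler 2) = ((a + b : ℕ) : ℂ) • co a b := linearMap_ext_mon fun p q => by
    simp only [LinearMap.comp_apply, euler_mon, map_smul, co_mon, LinearMap.smul_apply,
      smul_eq_mul]
    split_ifs with h
    · rw [h.1, h.2]
    · simp
  exact LinearMap.congr_fun this f

/-- The operator `∏_{k=1}^N (1 - ∇/k)`. It is evaluation at the origin for polynomials of degree at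
most `N`. -/
def truncEval : ℕ → Module.End ℂ (Poly 2)
  | 0 => 1
  | N + 1 => truncEval N * (1 - ((N : ℂ) + 1)⁻¹ • euler 2)

/-- The eigenvalue of `truncEval N` on polynomials of degree `d`. -/
def truncCoeff (N d : ℕ) : ℂ := ∏ k ∈ Finset.range N, (1 - ((k : ℂ) + 1)⁻¹ * d)

lemma truncEval_mon (N p q : ℕ) : truncEval N (mon p q) = truncCoeff N (p + q) • mon p q := by
  induction N with
  | zero => simp [truncEval, truncCoeff]
  | succ N ih =>
    rw [truncEval, Module.End.mul_apply, LinearMap.sub_apply, LinearMap.smul_apply, euler_mon,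
      Module.End.one_apply, smul_smul, ← one_smul ℂ (mon p q), smul_smul, ← sub_smul, map_smul, ih,
      smul_smul, one_smul, mul_one, truncCoeff, truncCoeff, Finset.prod_range_succ, mul_comm]

lemma truncCoeff_zero (N : ℕ) : truncCoeff N 0 = 1 := by simp [truncCoeff]

lemma truncCoeff_eq_zero {N d : ℕ} (h0 : 0 < d) (h : d ≤ N) : truncCoeff N d = 0 := by
  -- The factor with index `d - 1` is `1 - d/d`.
  refine Finset.prod_eq_zero (i := d - 1) (by simp; omega) ?_
  have : ((d - 1 : ℕ) : ℂ) + 1 = d := by exact_mod_cast Nat.sub_add_cancel h0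
  rw [this, inv_mul_cancel₀ (by exact_mod_cast h0.ne'), sub_self]

/-- The operator `truncEval N ∂₁^a ∂₂^b`. -/
def extract (N a b : ℕ) : Module.End ℂ (Poly 2) := truncEval N * del₁ ^ a * del₂ ^ b

/-- The scalar that occurs in the value of `extract N a b` at the monomial `x₁^p x₂^q`. -/
def extractCoeff (N a b p q : ℕ) : ℂ :=
  p.descFactorial a * q.descFactorial b * truncCoeff N (p - a + (q - b))

lemma extract_mon (N a b p q : ℕ) :
    extract N a b (mon p q) = extractCoeff N a b p q • mon (p - a) (q - b) := by
  rw [extract, Module.End.mul_apply, Module.End.mul_apply, del₂_pow_mon, map_smul, del₁_pow_mon,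
    map_smul, map_smul, truncEval_mon, smul_smul, smul_smul, extractCoeff]
  congr 1
  ring

/-- This ensures that the truncated differences `p - a` and `q - b` are genuine whenever they
matter. -/
lemma extractCoeff_ne_zero {N a b p q : ℕ} (h : extractCoeff N a b p q ≠ 0) : a ≤ p ∧ b ≤ q := by
  by_contra h'
  rw [not_and_or, not_le, not_le] at h'
  refine h ?_
  rw [extractCoeff]
  rcases h' with h' | h'
  · rw [Nat.descFactorial_of_lt h']
    simp
  · rw [Nat.descFactorial_of_lt h']
    simp

lemma extractCoeff_swap (N a b p q : ℕ) : extractCoeff N a b p q = extractCoeff N b a q p := by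
  rw [extractCoeff, extractCoeff, add_comm, mul_comm (p.descFactorial a : ℂ)]

/-- After differentiation the degree is at most `N`, so `truncEval N` leaves only the constant term,
which is the chosen coefficient times the factorials. -/
lemma extract_apply {N a b : ℕ} {f : Poly 2} (hf : ∀ p q, co p q f ≠ 0 → p + q ≤ N + a + b) :
    extract N a b f = ((a.factorial * b.factorial : ℕ) * co a b f) • (1 : Poly 2) := by
  let φ : Poly 2 →ₗ[ℂ] Poly 2 :=
    ((a.factorial * b.factorial : ℕ) : ℂ) • (co a b).smulRight (1 : Poly 2)
  have h : f ∈ LinearMap.ker (extract N a b - φ) := by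
    refine mem_of_mon fun p q hpq => ?_
    have hdeg := hf p q hpq
    rw [LinearMap.mem_ker, LinearMap.sub_apply, sub_eq_zero, extract_mon]
    simp only [φ, LinearMap.smul_apply, LinearMap.smulRight_apply, co_mon]
    split_ifs with h
    · rw [h.1, h.2, extractCoeff, Nat.descFactorial_self, Nat.descFactorial_self, Nat.sub_self,
        Nat.sub_self, truncCoeff_zero, mon_zero_zero]
      simp
    · by_cases h0 : extractCoeff N a b p q = 0
      · simp [h0]
      · have hle := extractCoeff_ne_zero h0
        rw [extractCoeff, truncCoeff_eq_zero (by omega) (by omega)]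
        simp
  rw [LinearMap.mem_ker, LinearMap.sub_apply, sub_eq_zero] at h
  rw [h]
  simp only [φ, LinearMap.smul_apply, LinearMap.smulRight_apply, smul_smul]

/-- Differentiation lowers the weight by `a - b`, and the Euler factors preserve it. -/
lemma extract_rotEnd (e N a b : ℕ) (f : Poly 2) :
    eps e ^ ((a : ℤ) - b) • rotEnd e (extract N a b f) = extract N a b (rotEnd e f) := by
  have : eps e ^ ((a : ℤ) - b) • (rotEnd e * extract N a b) = extract N a b * rotEnd e :=
    linearMap_ext_mon fun p q => by
      simp only [LinearMap.smul_apply, Module.End.mul_apply, rotEnd_mon, extract_mon, map_smul,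
        smul_smul]
      by_cases h : extractCoeff N a b p q = 0
      · simp [h]
      · have hle := extractCoeff_ne_zero h
        have h1 : ((a : ℤ) - b) + (((p - a : ℕ) : ℤ) - ((q - b : ℕ) : ℤ)) = p - q := by omega
        rw [mul_left_comm, ← zpow_add₀ (eps_ne_zero e), h1, mul_comm]
  exact LinearMap.congr_fun this f

lemma extract_swapEnd (N a b : ℕ) (f : Poly 2) :
    extract N a b (swapEnd f) = swapEnd (extract N b a f) := by
  have : extract N a b * swapEnd = swapEnd * extract N b a := linearMap_ext_mon fun p q => by
    simp only [Module.End.mul_apply, swapEnd_mon, extract_mon, map_smul,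
      extractCoeff_swap N a b q p]
  exact LinearMap.congr_fun this f

lemma euler_extract (N a b : ℕ) (f : Poly 2) :
    euler 2 (extract N a b f) =
      extract N a b (euler 2 f) - ((a + b : ℕ) : ℂ) • extract N a b f := by
  have : euler 2 * extract N a b =
      extract N a b * euler 2 - ((a + b : ℕ) : ℂ) • extract N a b :=
    linearMap_ext_mon fun p q => by
      simp only [LinearMap.sub_apply, LinearMap.smul_apply, Module.End.mul_apply, euler_mon,
        extract_mon, map_smul, smul_smul, ← sub_smul]
      by_cases h : extractCoeff N a b p q = 0
      · simp [h]
      · have hle := extractCoeff_ne_zero h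
        have h1 : (p + q : ℕ) = (p - a + (q - b)) + (a + b) := by omega
        rw [h1]
        congr 1
        push_cast
        ring
  exact LinearMap.congr_fun this f

/-- The operator `g ↦ (f ↦ (∂₁^a ∂₂^b f)(0) g + (∂₁^b ∂₂^a f)(0) σ(g))`, up to high degree. -/
def coeffOp (N a b : ℕ) (g : Poly 2) : Module.End ℂ (Poly 2) :=
  LinearMap.mulLeft ℂ g * extract N a b + LinearMap.mulLeft ℂ (swapEnd g) * extract N b a

lemma coeffOp_apply (N a b : ℕ) (g f : Poly 2) :
    coeffOp N a b g f = g * extract N a b f + swapEnd g * extract N b a f := rfl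

lemma coeffOp_eq {N a b : ℕ} {f : Poly 2} (g : Poly 2)
    (hf : ∀ p q, co p q f ≠ 0 → p + q ≤ N + a + b) :
    coeffOp N a b g f =
      ((a.factorial * b.factorial : ℕ) : ℂ) • (co a b f • g + co b a f • swapEnd g) := by
  rw [coeffOp_apply, extract_apply hf, extract_apply (fun p q h => by have := hf p q h; omega),
    mul_smul_comm, mul_smul_comm, mul_one, mul_one, smul_add, smul_smul, smul_smul,
    mul_comm b.factorial]

lemma mulLeft_mem_weyl (p : Poly 2) : LinearMap.mulLeft ℂ p ∈ weyl 2 := by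
  induction p using MvPolynomial.induction_on with
  | C c =>
    have : LinearMap.mulLeft ℂ (C c : Poly 2) = algebraMap ℂ _ c := by
      refine LinearMap.ext fun b => ?_
      simp [C_mul', Module.algebraMap_end_apply]
    rw [this]
    exact (weyl 2).algebraMap_mem c
  | add p q hp hq =>
    have : LinearMap.mulLeft ℂ (p + q) = LinearMap.mulLeft ℂ p + LinearMap.mulLeft ℂ q := by
      refine LinearMap.ext fun b => ?_
      simp [add_mul]
    rw [this]
    exact add_mem hp hq
  | mul_X p i hp =>
    rw [LinearMap.mulLeft_mul]
    exact mul_mem hp (Algebra.subset_adjoin (Or.inl ⟨i, rfl⟩))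

lemma del₁_mem_weyl : del₁ ∈ weyl 2 := Algebra.subset_adjoin (Or.inr ⟨0, rfl⟩)

lemma del₂_mem_weyl : del₂ ∈ weyl 2 := Algebra.subset_adjoin (Or.inr ⟨1, rfl⟩)

lemma euler_mem_weyl : euler 2 ∈ weyl 2 := by
  rw [euler_eq]
  exact add_mem (mul_mem (mulLeft_mem_weyl _) del₁_mem_weyl)
    (mul_mem (mulLeft_mem_weyl _) del₂_mem_weyl)

lemma extract_mem_weyl (N a b : ℕ) : extract N a b ∈ weyl 2 := by
  refine mul_mem (mul_mem ?_ (pow_mem del₁_mem_weyl a)) (pow_mem del₂_mem_weyl b)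
  induction N with
  | zero => exact one_mem _
  | succ N ih =>
    exact mul_mem ih (sub_mem (one_mem _) ((weyl 2).smul_mem euler_mem_weyl _))

/-- The weight of `g` compensates the weight removed by `extract`, so each summand commutes with the
rotation; the reflection exchanges the two summands. -/
lemma coeffOp_mem {e : ℕ} (he : 1 ≤ e) (N a b : ℕ) {g : Poly 2}
    (hg : g ∈ weightSpace e ((a : ℤ) - b)) : coeffOp N a b g ∈ invDiffOp (dihedral e) := by
  refine ⟨add_mem (mul_mem (mulLeft_mem_weyl _) (extract_mem_weyl N a b))
    (mul_mem (mulLeft_mem_weyl _) (extract_mem_weyl N b a)), ?_⟩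
  refine mem_centralizer_of_generators (fun f => ?_) fun f => ?_
  · have h1 := (mem_weightSpace_iff he).1 hg
    have h2 := (mem_weightSpace_iff he).1 (swapEnd_mem_weightSpace hg)
    rw [coeffOp_apply, coeffOp_apply, map_add, rotEnd_mul, rotEnd_mul, h1, h2,
      ← extract_rotEnd, ← extract_rotEnd, smul_mul_assoc, smul_mul_assoc, mul_smul_comm,
      mul_smul_comm, neg_sub]
  · rw [coeffOp_apply, coeffOp_apply, map_add, swapEnd_mul, swapEnd_mul, extract_swapEnd,
      extract_swapEnd, swapEnd_swapEnd, add_comm]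

lemma euler_swapEnd (f : Poly 2) : euler 2 (swapEnd f) = swapEnd (euler 2 f) := by
  have : euler 2 * swapEnd = swapEnd * euler 2 := linearMap_ext_mon fun p q => by
    simp only [Module.End.mul_apply, swapEnd_mon, euler_mon, map_smul, Nat.add_comm q p]
  exact LinearMap.congr_fun this f

lemma coeffOp_mem_degPart {e : ℕ} (he : 1 ≤ e) (N a b : ℕ) {d : ℕ} {g : Poly 2}
    (hg : g ∈ weightSpace e ((a : ℤ) - b)) (hd : euler 2 g = (d : ℂ) • g) :
    coeffOp N a b g ∈ degPart (dihedral e) (d - (a + b : ℕ)) := by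
  refine ⟨coeffOp_mem he N a b hg, LinearMap.ext fun f => ?_⟩
  have hd' : euler 2 (swapEnd g) = (d : ℂ) • swapEnd g := by rw [euler_swapEnd, hd, map_smul]
  have h2 := euler_extract N b a f
  rw [Nat.add_comm b a] at h2
  rw [LinearMap.sub_apply, Module.End.mul_apply, Module.End.mul_apply, LinearMap.smul_apply,
    coeffOp_apply, coeffOp_apply, map_add, euler_mul, euler_mul, hd, hd', h2,
    euler_extract N a b f, Int.cast_sub, Int.cast_natCast, Int.cast_natCast]
  generalize extract N a b f = u, extract N b a f = v, extract N a b (euler 2 f) = u',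
    extract N b a (euler 2 f) = v', swapEnd g = g', (d : ℂ) = r, ((a + b : ℕ) : ℂ) = t
  rw [smul_mul_assoc, smul_mul_assoc, mul_sub, mul_sub, mul_smul_comm, mul_smul_comm]
  module

/-! ### The weight spaces over the invariant ring -/

lemma weightSpace_congr {e : ℕ} {i j : ℤ} (h : (e : ℤ) ∣ i - j) :
    weightSpace e i = weightSpace e j := by
  ext f
  refine ⟨fun hf a b hab => ?_, fun hf a b hab => ?_⟩
  · rw [show (a : ℤ) - b - j = a - b - i + (i - j) by ring]
    exact dvd_add (hf a b hab) h
  · rw [show (a : ℤ) - b - i = a - b - j - (i - j) by ring]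
    exact dvd_sub (hf a b hab) h

/-- The algebra generated by `x₁^e + x₂^e` and `x₁ x₂`. -/
def basicInv (e : ℕ) : Subalgebra ℂ (Poly 2) :=
  Algebra.adjoin ℂ {x₁ ^ e + x₂ ^ e, x₁ * x₂}

lemma sum_mem_basicInv (e : ℕ) : x₁ ^ e + x₂ ^ e ∈ basicInv e :=
  Algebra.subset_adjoin (by simp)

lemma prod_mem_basicInv (e : ℕ) : x₁ * x₂ ∈ basicInv e :=
  Algebra.subset_adjoin (by simp)

lemma mon_left (a : ℕ) : mon a 0 = x₁ ^ a := by simp [mon]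

lemma mon_right (a : ℕ) : mon 0 a = x₂ ^ a := by simp [mon]

lemma swapEnd_x₁ (a : ℕ) : swapEnd (x₁ ^ a) = x₂ ^ a := by
  rw [← mon_left, swapEnd_mon, mon_right]

lemma swapEnd_x₂ (a : ℕ) : swapEnd (x₂ ^ a) = x₁ ^ a := by
  rw [← mon_right, swapEnd_mon, mon_left]

lemma basicInv_le (e : ℕ) : basicInv e ≤ A₂ e := by
  refine Algebra.adjoin_le ?_
  rintro _ (rfl | rfl)
  · refine mem_inv_iff.2 ⟨?_, ?_⟩
    · have h : (eps e) ^ (e : ℤ) = 1 := by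
        rcases Nat.eq_zero_or_pos e with rfl | he
        · simp
        · exact (eps_zpow_eq_one he).2 dvd_rfl
      rw [← mon_left, ← mon_right, map_add, rotEnd_mon, rotEnd_mon]
      simp [h]
    · rw [map_add, swapEnd_x₁, swapEnd_x₂, add_comm]
  · have h : x₁ * x₂ = mon 1 1 := by simp [mon]
    refine mem_inv_iff.2 ⟨?_, ?_⟩
    · rw [h, rotEnd_mon]
      simp
    · rw [h, swapEnd_mon]

/-- With `s = x^e + y^e` and `t = x y`, the powers satisfy `x^(i+e) = s x^i - t^i y^j` and then
`x^(n+2e) = s x^(n+e) - t^e x^n`. Keeping `x` and `y` abstract lets the lemma serve for both orders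
of the variables. -/
lemma pow_mem_of_recursion {e i j : ℕ} (hij : i + j = e) {x y : Poly 2}
    (hs : x ^ e + y ^ e ∈ basicInv e) (ht : x * y ∈ basicInv e)
    {U : Submodule (basicInv e) (Poly 2)} (hx : x ^ i ∈ U) (hy : y ^ j ∈ U) (k : ℕ) :
    x ^ (i + k * e) ∈ U := by
  suffices h : x ^ (i + k * e) ∈ U ∧ x ^ (i + (k + 1) * e) ∈ U from h.1
  induction k with
  | zero =>
    refine ⟨by simpa using hx, ?_⟩
    have h1 := U.sub_mem (U.smul_mem (⟨_, hs⟩ : basicInv e) hx)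
      (U.smul_mem ((⟨_, ht⟩ : basicInv e) ^ i) hy)
    convert h1 using 1
    simp only [Subalgebra.smul_def, SubmonoidClass.mk_pow, smul_eq_mul]
    rw [← hij]
    ring
  | succ k ih =>
    refine ⟨ih.2, ?_⟩
    have h1 := U.sub_mem (U.smul_mem (⟨_, hs⟩ : basicInv e) ih.2)
      (U.smul_mem ((⟨_, ht⟩ : basicInv e) ^ e) ih.1)
    convert h1 using 1
    simp only [Subalgebra.smul_def, SubmonoidClass.mk_pow, smul_eq_mul]
    ring

/-- The weight space of weight `j`, `0 ≤ j ≤ e`, is generated by `x₁^j` and `x₂^(e-j)`. -/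
lemma weightSpace_le_span {e j : ℕ} (hj : j ≤ e) {f : Poly 2} (hf : f ∈ weightSpace e j) :
    ∃ a ∈ basicInv e, ∃ a' ∈ basicInv e, f = a * x₁ ^ j + a' * x₂ ^ (e - j) := by
  let U : Submodule (basicInv e) (Poly 2) := Submodule.span _ {x₁ ^ j, x₂ ^ (e - j)}
  have hx : x₁ ^ j ∈ U := Submodule.subset_span (by simp)
  have hy : x₂ ^ (e - j) ∈ U := Submodule.subset_span (by simp)
  have hs := sum_mem_basicInv e
  have ht := prod_mem_basicInv e
  have h : f ∈ U.restrictScalars ℂ := by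
    refine mem_of_mon fun a b hab => ?_
    rw [Submodule.restrictScalars_mem]
    -- Here `a - b = j + e k`. After splitting off a power of `x₁ x₂`, a pure power of `x₁` remains
    -- if `k ≥ 0`, and of `x₂` if `k < 0`.
    obtain ⟨k, hk⟩ := hf a b hab
    rcases le_or_gt 0 k with hk0 | hk0
    · lift k to ℕ using hk0
      have ha : a = b + (j + k * e) := by
        zify
        linarith
      have h1 := U.smul_mem ((⟨_, ht⟩ : basicInv e) ^ b)
        (pow_mem_of_recursion (by omega : j + (e - j) = e) hs ht hx hy k)
      convert h1 using 1
      simp only [Subalgebra.smul_def, SubmonoidClass.mk_pow, smul_eq_mul, mon]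
      rw [ha, pow_add x₁ b, mul_pow]
      ring
    · obtain ⟨m, hm⟩ : ∃ m : ℕ, k = -(m : ℤ) - 1 := ⟨(-k - 1).toNat, by omega⟩
      have hb : b = a + (e - j + m * e) := by
        zify [hj]
        rw [hm] at hk
        linarith
      have h1 := U.smul_mem ((⟨_, ht⟩ : basicInv e) ^ a)
        (pow_mem_of_recursion (by omega : e - j + j = e) (by rwa [add_comm]) (by rwa [mul_comm])
          hy hx m)
      convert h1 using 1
      simp only [Subalgebra.smul_def, SubmonoidClass.mk_pow, smul_eq_mul, mon]
      rw [hb, pow_add x₂ a, mul_pow]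
      ring
  obtain ⟨a, a', h⟩ := Submodule.mem_span_pair.1 h
  exact ⟨a, a.2, a', a'.2, h.symm⟩

lemma swapEnd_of_mem_inv {e : ℕ} {a : Poly 2} (ha : a ∈ A₂ e) : swapEnd a = a :=
  (mem_inv_iff.1 ha).2

/-- An invariant has weight `0`, hence the form `a + a' x₂^e`; averaging with its reflection turns
`x₂^e` into `(x₁^e + x₂^e)/2`. -/
lemma inv_eq_basicInv {e : ℕ} (he : 1 ≤ e) : A₂ e = basicInv e := by
  refine le_antisymm (fun f hf => ?_) (basicInv_le e)
  have hw : f ∈ weightSpace e (0 : ℕ) := by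
    rw [mem_weightSpace_iff he]
    simpa using (mem_inv_iff.1 hf).1
  obtain ⟨a, ha, a', ha', h⟩ := weightSpace_le_span (Nat.zero_le e) hw
  have h1 : swapEnd f = a + a' * x₁ ^ e := by
    rw [h, map_add, swapEnd_mul, swapEnd_mul, swapEnd_of_mem_inv (basicInv_le e ha),
      swapEnd_of_mem_inv (basicInv_le e ha'), swapEnd_x₂, swapEnd_x₁]
    simp
  rw [swapEnd_of_mem_inv hf] at h1
  have h2 : f = a + (1 / 2 : ℂ) • (a' * (x₁ ^ e + x₂ ^ e)) := by
    have h3 : (2 : ℂ) • f = (2 : ℂ) • a + a' * (x₁ ^ e + x₂ ^ e) := by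
      rw [two_smul, two_smul]
      nth_rewrite 1 [h]
      rw [h1]
      simp
      ring
    have h4 := congrArg (fun z => (1 / 2 : ℂ) • z) h3
    simpa [smul_smul] using h4
  rw [h2]
  exact add_mem ha ((basicInv e).smul_mem (mul_mem ha' (sum_mem_basicInv e)) _)

lemma mul_mem_weightSpace {e : ℕ} (he : 1 ≤ e) {j : ℤ} {a f : Poly 2} (ha : a ∈ A₂ e)
    (hf : f ∈ weightSpace e j) : a * f ∈ weightSpace e j := by
  rw [mem_weightSpace_iff he] at hf ⊢
  rw [rotEnd_mul, (mem_inv_iff.1 ha).1, hf, mul_smul_comm]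

/-! ### The basis over the invariant ring -/

lemma mon_ne {a b p q : ℕ} (h : a ≠ p) : mon a b - mon p q ≠ 0 := by
  intro h0
  have h1 := congrArg (co a b) h0
  rw [map_sub, co_mon, co_mon, map_zero, if_pos ⟨rfl, rfl⟩, if_neg (by tauto)] at h1
  simp at h1

lemma pow_sub_pow_ne_zero {n : ℕ} (hn : 1 ≤ n) : x₁ ^ n - x₂ ^ n ≠ (0 : Poly 2) := by
  rw [← mon_left, ← mon_right]
  exact mon_ne (by omega)

lemma pow_add_pow_ne_zero (n : ℕ) : x₁ ^ n + x₂ ^ n ≠ (0 : Poly 2) := by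
  rw [← mon_left, ← mon_right]
  intro h0
  have h1 := congrArg (co n 0) h0
  rw [map_add, co_mon, co_mon, map_zero, if_pos ⟨rfl, rfl⟩] at h1
  split_ifs at h1 <;> norm_num at h1

/-- If `a f + a' f' = 0` with invariant `a`, `a'` then the same holds for the images of `f`, `f'`
under the reflection; so `a = a' = 0` if the determinant does not vanish. -/
lemma eq_zero_of_det_ne_zero {e : ℕ} {a a' f f' : Poly 2} (ha : a ∈ A₂ e) (ha' : a' ∈ A₂ e)
    (h : a * f + a' * f' = 0) (hd : f * swapEnd f' - f' * swapEnd f ≠ 0) : a = 0 ∧ a' = 0 := by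
  have h1 := congrArg swapEnd h
  rw [map_add, swapEnd_mul, swapEnd_mul, swapEnd_of_mem_inv ha, swapEnd_of_mem_inv ha',
    map_zero] at h1
  have h2 : a * (f * swapEnd f' - f' * swapEnd f) = 0 := by
    linear_combination swapEnd f' * h - f' * h1
  have h3 : a' * (f * swapEnd f' - f' * swapEnd f) = 0 := by
    linear_combination f * h1 - swapEnd f * h
  exact ⟨(mul_eq_zero.1 h2).resolve_right hd, (mul_eq_zero.1 h3).resolve_right hd⟩

/-- The determinant of this pair is `x₁^e - x₂^e`. -/
lemma eq_zero_of_pow {e i j : ℕ} (he : 1 ≤ e) (hij : i + j = e) {a a' : Poly 2} (ha : a ∈ A₂ e)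
    (ha' : a' ∈ A₂ e) (h : a * x₁ ^ i + a' * x₂ ^ j = 0) : a = 0 ∧ a' = 0 := by
  refine eq_zero_of_det_ne_zero ha ha' h ?_
  rw [swapEnd_x₁, swapEnd_x₂, ← pow_add, ← pow_add, add_comm j, hij]
  exact pow_sub_pow_ne_zero he

lemma eq_zero_of_one_jac {e : ℕ} (he : 1 ≤ e) {a a' : Poly 2} (ha : a ∈ A₂ e)
    (ha' : a' ∈ A₂ e) (h : a * 1 + a' * (x₁ ^ e - x₂ ^ e) = 0) : a = 0 ∧ a' = 0 := by
  refine eq_zero_of_det_ne_zero ha ha' h ?_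
  have h1 : swapEnd (1 : Poly 2) = 1 := by rw [← mon_zero_zero, swapEnd_mon]
  rw [h1, map_sub, swapEnd_x₁, swapEnd_x₂]
  have h2 : (1 * (x₂ ^ e - x₁ ^ e) - (x₁ ^ e - x₂ ^ e) * 1 : Poly 2) =
      (-2 : ℂ) • (x₁ ^ e - x₂ ^ e) := by
    rw [one_mul, mul_one]
    module
  rw [h2]
  exact smul_ne_zero (by norm_num) (pow_sub_pow_ne_zero he)

/-- The weights of the basis elements. -/
def basisWt {e : ℕ} : BasisIndex e → ℤ
  | .one => 0
  | .pow₁ i _ _ => i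
  | .pow₂ i _ _ => -i
  | .jac => 0

/-- The other basis index with the same weight. -/
def partner {e : ℕ} : BasisIndex e → BasisIndex e
  | .one => .jac
  | .pow₁ i h h' => .pow₂ (e - i) (by omega) (by omega)
  | .pow₂ i h h' => .pow₁ (e - i) (by omega) (by omega)
  | .jac => .one

lemma partner_ne {e : ℕ} (k : BasisIndex e) : k ≠ partner k := by
  cases k <;> simp [partner]

lemma eq_zero_of_dvd_of_lt {e : ℕ} {z : ℤ} (h : (e : ℤ) ∣ z) (h1 : -(e : ℤ) < z) (h2 : z < e) :
    z = 0 :=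
  Int.eq_zero_of_abs_lt_dvd h (abs_lt.2 ⟨h1, h2⟩)

/-- The weights lie strictly between `-e` and `e`, and each class modulo `e` occurs exactly twice.
-/
lemma eq_or_eq_partner {e : ℕ} {k k' : BasisIndex e}
    (h : (e : ℤ) ∣ basisWt k' - basisWt k) : k' = k ∨ k' = partner k := by
  rcases k with _ | ⟨i, hi, hi'⟩ | ⟨i, hi, hi'⟩ | _ <;>
  rcases k' with _ | ⟨j, hj, hj'⟩ | ⟨j, hj, hj'⟩ | _ <;>
  simp only [basisWt, partner, reduceCtorEq, or_false, false_or, or_true,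
    BasisIndex.pow₁.injEq, BasisIndex.pow₂.injEq] at h ⊢
  case pow₁.pow₂ =>
    -- The difference lies strictly between `-2e` and `0`; the shift by `e` brings it into the range
    -- where divisibility forces zero.
    have := eq_zero_of_dvd_of_lt (z := -j - i + e) (dvd_add h dvd_rfl) (by omega) (by omega)
    omega
  case pow₂.pow₁ =>
    have := eq_zero_of_dvd_of_lt (z := j - -i - e) (dvd_sub h dvd_rfl) (by omega) (by omega)
    omega
  all_goals
    have := eq_zero_of_dvd_of_lt h (by omega) (by omega)
    omega

lemma dvd_basisWt_partner {e : ℕ} (k : BasisIndex e) :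
    (e : ℤ) ∣ basisWt (partner k) - basisWt k := by
  rcases k with _ | ⟨i, hi, hi'⟩ | ⟨i, hi, hi'⟩ | _
  · simp [basisWt, partner]
  · refine ⟨-1, ?_⟩
    simp only [basisWt, partner]
    omega
  · refine ⟨1, ?_⟩
    simp only [basisWt, partner]
    omega
  · simp [basisWt, partner]

lemma basisElt_mem {e : ℕ} (k : BasisIndex e) : basisElt k ∈ weightSpace e (basisWt k) := by
  rcases k with _ | ⟨i, hi, hi'⟩ | ⟨i, hi, hi'⟩ | _
  · rw [basisElt, ← mon_zero_zero]
    exact mon_mem_weightSpace (by simp [basisWt])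
  · rw [basisElt, ← mon_left]
    exact mon_mem_weightSpace (by simp [basisWt])
  · rw [basisElt, ← mon_right]
    exact mon_mem_weightSpace (by simp [basisWt])
  · rw [basisElt, ← mon_left, ← mon_right]
    exact sub_mem (mon_mem_weightSpace (by simp [basisWt]))
      (mon_mem_weightSpace (by simp [basisWt]))

lemma eq_zero_of_partner {e : ℕ} (he : 1 ≤ e) (k : BasisIndex e) {a a' : Poly 2} (ha : a ∈ A₂ e)
    (ha' : a' ∈ A₂ e) (h : a * basisElt k + a' * basisElt (partner k) = 0) : a = 0 := by
  rcases k with _ | ⟨i, hi, hi'⟩ | ⟨i, hi, hi'⟩ | _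
  · exact (eq_zero_of_one_jac he ha ha' h).1
  · exact (eq_zero_of_pow he (by omega : i + (e - i) = e) ha ha' h).1
  · rw [add_comm] at h
    exact (eq_zero_of_pow he (by omega : e - i + i = e) ha' ha h).2
  · rw [add_comm] at h
    exact (eq_zero_of_one_jac he ha' ha h).2

/-- The components of a fixed weight of a vanishing sum vanish. -/
lemma sum_filter_eq_zero {e : ℕ} {ι : Type*} (s : Finset ι) (u : ι → Poly 2) (w : ι → ℤ)
    (hu : ∀ k ∈ s, u k ∈ weightSpace e (w k)) (h : ∑ k ∈ s, u k = 0) (j : ℤ)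
    [DecidablePred fun k => (e : ℤ) ∣ w k - j] :
    ∑ k ∈ s with (e : ℤ) ∣ w k - j, u k = 0 := by
  refine ext_co fun a b => ?_
  rw [map_zero]
  by_cases hab : (e : ℤ) ∣ a - b - j
  · have h1 := congrArg (co a b) h
    rw [map_zero, map_sum, ← Finset.sum_filter_add_sum_filter_not s
      (fun k => (e : ℤ) ∣ w k - j)] at h1
    rw [Finset.sum_eq_zero (s := s.filter fun k => ¬ (e : ℤ) ∣ w k - j), add_zero] at h1
    · rw [map_sum, h1]
    · intro k hk
      rw [Finset.mem_filter] at hk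
      by_contra hne
      refine hk.2 ?_
      rw [show w k - j = (a - b - j) - (a - b - w k) by ring]
      exact dvd_sub hab (hu k hk.1 a b hne)
  · rw [map_sum]
    refine Finset.sum_eq_zero fun k hk => ?_
    rw [Finset.mem_filter] at hk
    by_contra hne
    refine hab ?_
    rw [show (a : ℤ) - b - j = (a - b - w k) + (w k - j) by ring]
    exact dvd_add (hu k hk.1 a b hne) hk.2

/-- Multiplication by invariants preserves weights, so a relation splits by weight into relations
between an element and its partner, which the determinant settles. -/
lemma linearIndependent_basisElt {e : ℕ} (he : 1 ≤ e) :
    LinearIndependent (A₂ e) (basisElt : BasisIndex e → Poly 2) := by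
  classical
  rw [linearIndependent_iff'']
  intro s g hg hsum k
  have h1 := sum_filter_eq_zero (e := e) s (fun k => g k • basisElt k) basisWt
    (fun k _ => mul_mem_weightSpace he (g k).2 (basisElt_mem k)) hsum (basisWt k)
  have hsub : s.filter (fun k' => (e : ℤ) ∣ basisWt k' - basisWt k) ⊆ {k, partner k} := by
    intro k' hk'
    rw [Finset.mem_filter] at hk'
    simpa using eq_or_eq_partner hk'.2
  rw [Finset.sum_subset hsub, Finset.sum_pair (partner_ne k)] at h1
  · exact Subtype.ext (eq_zero_of_partner he k (g k).2 (g (partner k)).2 h1)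
  · intro k' hk' hns
    rw [hg k', zero_smul]
    intro hs
    refine hns (Finset.mem_filter.2 ⟨hs, ?_⟩)
    rcases Finset.mem_insert.1 hk' with rfl | hk'
    · simp
    · rw [Finset.mem_singleton.1 hk']
      exact dvd_basisWt_partner k

lemma span_basisElt {e : ℕ} (he : 1 ≤ e) :
    ⊤ ≤ Submodule.span (A₂ e) (Set.range (basisElt : BasisIndex e → Poly 2)) := by
  set U := Submodule.span (A₂ e) (Set.range (basisElt : BasisIndex e → Poly 2)) with hU
  have hmem : ∀ k : BasisIndex e, basisElt k ∈ U := fun k => Submodule.subset_span ⟨k, rfl⟩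
  have hmul : ∀ a ∈ basicInv e, ∀ f ∈ U, a * f ∈ U := fun a ha f hf =>
    U.smul_mem (⟨a, basicInv_le e ha⟩ : A₂ e) hf
  intro f _
  suffices h : f ∈ U.restrictScalars ℂ from h
  refine mem_of_mon fun a b _ => ?_
  rw [Submodule.restrictScalars_mem]
  have he' : (0 : ℤ) < e := by exact_mod_cast he
  obtain ⟨j, hj⟩ : ∃ j : ℕ, (j : ℤ) = ((a : ℤ) - b) % e :=
    ⟨(((a : ℤ) - b) % e).toNat, Int.toNat_of_nonneg (Int.emod_nonneg _ he'.ne')⟩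
  have hlt : j < e := by
    have := Int.emod_lt_of_pos ((a : ℤ) - b) he'
    omega
  have hw : mon a b ∈ weightSpace e j := by
    refine mon_mem_weightSpace ?_
    rw [hj]
    exact Int.dvd_self_sub_emod
  obtain ⟨c, hc, c', hc', h⟩ := weightSpace_le_span hlt.le hw
  rw [h]
  rcases Nat.eq_zero_or_pos j with rfl | hj0
  -- In weight `0` the generator `x₂^e` is not in the basis; it equals half of `(x₁^e + x₂^e) -
  -- (x₁^e - x₂^e)`.
  · have h1 : c * x₁ ^ 0 + c' * x₂ ^ (e - 0) = (c + (1 / 2 : ℂ) • (c' * (x₁ ^ e + x₂ ^ e))) * 1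
        + ((-1 / 2 : ℂ) • c') * (x₁ ^ e - x₂ ^ e) := by
      simp only [smul_mul_assoc, pow_zero, mul_one, mul_add, mul_sub, Nat.sub_zero]
      module
    rw [h1]
    exact U.add_mem (hmul _ (add_mem hc ((basicInv e).smul_mem
      (mul_mem hc' (sum_mem_basicInv e)) _)) _ (hmem .one))
      (hmul _ ((basicInv e).smul_mem hc' _) _ (hmem .jac))
  · exact U.add_mem (hmul _ hc _ (hmem (.pow₁ j hj0 (by omega))))
      (hmul _ hc' _ (hmem (.pow₂ (e - j) (by omega) (by omega))))

lemma exists_basis {e : ℕ} (he : 1 ≤ e) :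
    ∃ b : Module.Basis (BasisIndex e) (A₂ e) (Poly 2), ∀ k, b k = basisElt k :=
  ⟨Module.Basis.mk (linearIndependent_basisElt he) (span_basisElt he),
    fun k => Module.Basis.mk_apply _ _ k⟩

/-! ### The modules `M` as isotypic components -/

variable {e : ℕ}

/-- The weight of the generator of `M c`. -/
def wt : Label e → ℤ
  | .zero => 0
  | .jac => 0
  | .pow₁ i _ _ => i
  | .pow₂ i _ _ => -i
  | .I e₁ _ => e₁
  | .II e₁ _ => e₁

/-- The eigenvalue of the reflection on the generator of `M c`, or `0` if it is not an
eigenvector. -/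
def sg : Label e → ℂ
  | .zero => 1
  | .jac => -1
  | .pow₁ _ _ _ => 0
  | .pow₂ _ _ _ => 0
  | .I _ _ => 1
  | .II _ _ => -1

/-- The degree of the generator of `M c`. -/
def deg : Label e → ℕ
  | .zero => 0
  | .jac => e
  | .pow₁ i _ _ => i
  | .pow₂ i _ _ => i
  | .I e₁ _ => e₁
  | .II e₁ _ => e₁

/-- The label of the image of `M c` under the reflection. -/
def flip : Label e → Label e
  | .zero => .zero
  | .jac => .jac
  | .pow₁ i h h' => .pow₂ i h h'
  | .pow₂ i h h' => .pow₁ i h h'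
  | .I e₁ h => .I e₁ h
  | .II e₁ h => .II e₁ h

lemma sg_cases (c : Label e) : sg c = 0 ∨ sg c = 1 ∨ sg c = -1 := by
  cases c <;> simp [sg]

lemma sg_mul_self {c : Label e} (h : sg c ≠ 0) : sg c * sg c = 1 := by
  rcases sg_cases c with h' | h' | h'
  · exact absurd h' h
  · rw [h', mul_one]
  · rw [h']
    norm_num

/-- Together with `not_dvd_two_wt`: a sign is attached exactly to the weights that equal their
negative modulo `e`. -/
lemma dvd_two_wt {c : Label e} (h : sg c ≠ 0) : (e : ℤ) ∣ 2 * wt c := by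
  rcases c with _ | _ | ⟨i, hi, hi'⟩ | ⟨i, hi, hi'⟩ | ⟨i, hi⟩ | ⟨i, hi⟩
  · simp [wt]
  · simp [wt]
  · simp [sg] at h
  · simp [sg] at h
  · exact ⟨1, by simp only [wt]; omega⟩
  · exact ⟨1, by simp only [wt]; omega⟩

lemma not_dvd_two_wt {c : Label e} (h : sg c = 0) : ¬ (e : ℤ) ∣ 2 * wt c := by
  rcases c with _ | _ | ⟨i, hi, hi'⟩ | ⟨i, hi, hi'⟩ | ⟨i, hi⟩ | ⟨i, hi⟩
  · simp [sg] at h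
  · simp [sg] at h
  · intro h'
    have := eq_zero_of_dvd_of_lt h' (by simp only [wt]; omega) (by simp only [wt]; omega)
    simp only [wt] at this
    omega
  · intro h'
    have := eq_zero_of_dvd_of_lt h' (by simp only [wt]; omega) (by simp only [wt]; omega)
    simp only [wt] at this
    omega
  · simp [sg] at h
  · simp [sg] at h

lemma wt_flip (c : Label e) : (e : ℤ) ∣ -wt c - wt (flip c) := by
  by_cases h : sg c = 0
  · cases c <;> simp_all [wt, flip, sg]
  · have h1 : wt (flip c) = wt c := by
      cases c <;> simp_all [wt, flip, sg]
    rw [h1, show -wt c - wt c = -(2 * wt c) by ring, dvd_neg]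
    exact dvd_two_wt h

lemma sg_flip (c : Label e) : sg (flip c) = sg c := by cases c <;> rfl

lemma flip_flip (c : Label e) : flip (flip c) = c := by cases c <;> rfl

lemma flip_eq_self {c : Label e} (h : sg c ≠ 0) : flip c = c := by
  cases c <;> simp_all [flip, sg]

lemma flip_ne_self {c : Label e} (h : sg c = 0) : flip c ≠ c := by
  cases c <;> simp_all [flip, sg]

/-- Here the difference of the two weights is less than `e` in absolute value, so congruent weights
are equal, and a weight without sign belongs to one label only. -/
lemma ne_of_sg_eq_zero {c c' : Label e} (h : sg c = 0) (hne : c' ≠ c) :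
    ¬ (e : ℤ) ∣ wt c' - wt c := by
  intro hd
  refine hne ?_
  rcases c with _ | _ | ⟨i, hi, hi'⟩ | ⟨i, hi, hi'⟩ | ⟨i, hi⟩ | ⟨i, hi⟩ <;>
  first
  | simp [sg] at h; done
  | rcases c' with _ | _ | ⟨j, hj, hj'⟩ | ⟨j, hj, hj'⟩ | ⟨j, hj⟩ | ⟨j, hj⟩ <;>
    simp only [wt] at hd <;>
    have := eq_zero_of_dvd_of_lt hd (by omega) (by omega) <;>
    first
    | omega
    | (congr; omega)

lemma wt_sg_injective {c c' : Label e} (he : 1 ≤ e) (h : (e : ℤ) ∣ wt c' - wt c)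
    (hs : sg c' = sg c) : c' = c := by
  by_cases h0 : sg c = 0
  · by_contra hne
    exact ne_of_sg_eq_zero h0 hne h
  · have h0' : sg c' ≠ 0 := hs ▸ h0
    -- The two self-inverse weights `0` and `e/2` are distinct modulo `e`.
    have hz : ∀ j : ℕ, e = 2 * j → ¬ (e : ℤ) ∣ j := by
      intro j hj hd
      have := eq_zero_of_dvd_of_lt hd (by omega) (by omega)
      omega
    rcases c with _ | _ | ⟨i, hi, hi'⟩ | ⟨i, hi, hi'⟩ | ⟨i, hi⟩ | ⟨i, hi⟩ <;>
    rcases c' with _ | _ | ⟨j, hj, hj'⟩ | ⟨j, hj, hj'⟩ | ⟨j, hj⟩ | ⟨j, hj⟩ <;>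
    simp only [wt, sg] at * <;>
    first
    | rfl
    | exact absurd rfl h0
    | exact absurd rfl h0'
    | (norm_num at hs; done)
    | (exact absurd (by simpa using h) (hz _ hi))
    | (exact absurd (by simpa using h) (hz _ hj))
    | (congr; omega)

/-- The isotypic component of `B` that belongs to `c`. -/
def isoComp (c : Label e) : Submodule ℂ (Poly 2) where
  carrier := {f | f ∈ weightSpace e (wt c) ∧ (sg c ≠ 0 → swapEnd f = sg c • f)}
  zero_mem' := ⟨zero_mem _, fun _ => by simp⟩
  add_mem' := by
    rintro f g ⟨hf, hf'⟩ ⟨hg, hg'⟩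
    exact ⟨add_mem hf hg, fun h => by rw [map_add, hf' h, hg' h, smul_add]⟩
  smul_mem' := by
    rintro r f ⟨hf, hf'⟩
    exact ⟨Submodule.smul_mem _ _ hf, fun h => by rw [map_smul, hf' h, smul_comm]⟩

lemma co_swap_of_mem {c : Label e} {f : Poly 2} (hf : f ∈ isoComp c) (h : sg c ≠ 0) (a b : ℕ) :
    co b a f = sg c * co a b f := by
  rw [← co_swapEnd, hf.2 h, map_smul, smul_eq_mul]

lemma co_swap_eq_zero {c : Label e} {f : Poly 2} (hf : f ∈ isoComp c) (h : sg c = 0) {a b : ℕ}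
    (hab : (e : ℤ) ∣ a - b - wt c) : co b a f = 0 := by
  by_contra hne
  refine not_dvd_two_wt h ?_
  have h1 := hf.1 b a hne
  rw [show 2 * wt c = -(((a : ℤ) - b - wt c) + (b - a - wt c)) by ring, dvd_neg]
  exact dvd_add hab h1

/-- The sum of the isotypic components different from `isoComp c`. -/
def coComp (c : Label e) : Submodule ℂ (Poly 2) where
  carrier := {f | ∀ a b : ℕ, (e : ℤ) ∣ a - b - wt c → co a b f + sg c * co b a f = 0}
  zero_mem' := by simp
  add_mem' := by
    intro f g hf hg a b h
    rw [map_add, map_add]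
    linear_combination hf a b h + hg a b h
  smul_mem' := by
    intro r f hf a b h
    rw [map_smul, map_smul, smul_eq_mul, smul_eq_mul]
    linear_combination r * hf a b h

/-- On `isoComp c` the functional that defines `coComp c` is the coefficient itself if `sg c = 0`,
and twice the coefficient otherwise. -/
lemma eq_zero_of_mem_isoComp_coComp {c : Label e} {f : Poly 2} (hf : f ∈ isoComp c)
    (hf' : f ∈ coComp c) : f = 0 := by
  refine ext_co fun a b => ?_
  rw [map_zero]
  by_contra hne
  have h1 := hf' a b (hf.1 a b hne)
  by_cases h : sg c = 0
  · rw [h, zero_mul, add_zero] at h1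
    exact hne h1
  · rw [co_swap_of_mem hf h a b, ← mul_assoc, sg_mul_self h, one_mul, ← two_mul] at h1
    exact hne ((mul_eq_zero.1 h1).resolve_left two_ne_zero)

/-- Either the weights differ, and both coefficients vanish, or they agree with opposite signs, and
the two terms cancel. -/
lemma isoComp_le_coComp (he : 1 ≤ e) {c c' : Label e} (h : c' ≠ c) : isoComp c' ≤ coComp c := by
  intro f hf a b hab
  by_cases hd : (e : ℤ) ∣ wt c' - wt c
  · have hs : sg c' ≠ sg c := fun hs => h (wt_sg_injective he hd hs)
    have h0 : sg c ≠ 0 := fun h0 => ne_of_sg_eq_zero h0 h hd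
    have h0' : sg c' ≠ 0 := fun h0' => ne_of_sg_eq_zero h0' h.symm (by
      rwa [← dvd_neg, neg_sub])
    have h1 : sg c * sg c' = -1 := by
      rcases sg_cases c with h1 | h1 | h1 <;> rcases sg_cases c' with h2 | h2 | h2 <;>
      simp_all
    rw [co_swap_of_mem hf h0' a b, ← mul_assoc, h1]
    ring
  · have hz : ∀ p q : ℕ, (e : ℤ) ∣ p - q - wt c → co p q f = 0 := by
      intro p q hpq
      by_contra hne
      refine hd ?_
      rw [show wt c' - wt c = ((p : ℤ) - q - wt c) - (p - q - wt c') by ring]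
      exact dvd_sub hpq (hf.1 p q hne)
    rw [hz a b hab, zero_add]
    by_cases h0 : sg c = 0
    · rw [h0, zero_mul]
    · rw [hz b a, mul_zero]
      rw [show (b : ℤ) - a - wt c = -((a - b - wt c) + 2 * wt c) by ring, dvd_neg]
      exact dvd_add hab (dvd_two_wt h0)

lemma swapEnd_mem_isoComp {c : Label e} {f : Poly 2} (hf : f ∈ isoComp c) :
    swapEnd f ∈ isoComp (flip c) := by
  refine ⟨?_, fun h => ?_⟩
  · rw [← weightSpace_congr (wt_flip c)]
    exact swapEnd_mem_weightSpace hf.1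
  · rw [sg_flip] at h ⊢
    rw [hf.2 h, map_smul, hf.2 h]

lemma gen_mem (c : Label e) : gen c ∈ isoComp c := by
  have h1 : ∀ (i : ℕ) (j : ℤ), (e : ℤ) ∣ i - j → x₁ ^ i ∈ weightSpace e j := by
    intro i j h
    rw [← mon_left]
    exact mon_mem_weightSpace (by simpa using h)
  have h2 : ∀ (i : ℕ) (j : ℤ), (e : ℤ) ∣ -i - j → x₂ ^ i ∈ weightSpace e j := by
    intro i j h
    rw [← mon_right]
    exact mon_mem_weightSpace (by simpa using h)
  rcases c with _ | _ | ⟨i, hi, hi'⟩ | ⟨i, hi, hi'⟩ | ⟨i, hi⟩ | ⟨i, hi⟩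
  · refine ⟨?_, fun _ => ?_⟩
    · simpa [gen, wt] using h1 0 0 (by simp)
    · simpa [gen, sg] using swapEnd_x₁ 0
  · refine ⟨sub_mem (h1 _ _ (by simp [wt])) (h2 _ _ (by simp [wt])), fun _ => ?_⟩
    simp [gen, sg, swapEnd_x₁, swapEnd_x₂]
  · exact ⟨h1 _ _ (by simp [wt]), by simp [sg]⟩
  · exact ⟨h2 _ _ (by simp [wt]), by simp [sg]⟩
  · refine ⟨add_mem (h1 _ _ (by simp [wt])) (h2 _ _ ⟨-1, by simp only [wt]; omega⟩), fun _ => ?_⟩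
    simp [gen, sg, swapEnd_x₁, swapEnd_x₂, add_comm]
  · refine ⟨sub_mem (h1 _ _ (by simp [wt])) (h2 _ _ ⟨-1, by simp only [wt]; omega⟩), fun _ => ?_⟩
    simp [gen, sg, swapEnd_x₁, swapEnd_x₂]

lemma gen_ne_zero (he : 1 ≤ e) (c : Label e) : gen c ≠ 0 := by
  rcases c with _ | _ | ⟨i, hi, hi'⟩ | ⟨i, hi, hi'⟩ | ⟨i, hi⟩ | ⟨i, hi⟩
  · exact one_ne_zero
  · exact pow_sub_pow_ne_zero he
  · exact pow_ne_zero _ (X_ne_zero _)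
  · exact pow_ne_zero _ (X_ne_zero _)
  · exact pow_add_pow_ne_zero _
  · exact pow_sub_pow_ne_zero (by omega)

lemma euler_gen (c : Label e) : euler 2 (gen c) = (deg c : ℂ) • gen c := by
  have h1 : ∀ i : ℕ, euler 2 (x₁ ^ i) = (i : ℂ) • x₁ ^ i := fun i => by
    rw [← mon_left, euler_mon, add_zero]
  have h2 : ∀ i : ℕ, euler 2 (x₂ ^ i) = (i : ℂ) • x₂ ^ i := fun i => by
    rw [← mon_right, euler_mon, zero_add]
  rcases c with _ | _ | ⟨i, hi, hi'⟩ | ⟨i, hi, hi'⟩ | ⟨i, hi⟩ | ⟨i, hi⟩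
  · simpa [gen, deg] using h1 0
  · simp only [gen, deg, map_sub, h1, h2, smul_sub]
  · exact h1 i
  · exact h2 i
  · simp only [gen, deg, map_add, h1, h2, smul_add]
  · simp only [gen, deg, map_sub, h1, h2, smul_sub]

lemma add_eq_deg {c : Label e} {a b : ℕ} (h : co a b (gen c) ≠ 0) : a + b = deg c := by
  have h1 := congrArg (co a b) (euler_gen c)
  rw [co_euler, map_smul, smul_eq_mul] at h1
  exact_mod_cast mul_right_cancel₀ h h1

/-- The exponent of the leading monomial of the generator of `M c`. -/
def lead : Label e → ℕ × ℕ
  | .zero => (0, 0)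
  | .jac => (e, 0)
  | .pow₁ i _ _ => (i, 0)
  | .pow₂ i _ _ => (0, i)
  | .I e₁ _ => (e₁, 0)
  | .II e₁ _ => (e₁, 0)

lemma co_lead_gen (he : 1 ≤ e) (c : Label e) : co (lead c).1 (lead c).2 (gen c) = 1 := by
  rcases c with _ | _ | ⟨i, hi, hi'⟩ | ⟨i, hi, hi'⟩ | ⟨i, hi⟩ | ⟨i, hi⟩
  · rw [gen, ← mon_zero_zero, co_mon, if_pos ⟨rfl, rfl⟩]
  · rw [gen, ← mon_left, ← mon_right, map_sub, co_mon, co_mon, if_pos ⟨rfl, rfl⟩, if_neg, sub_zero]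
    simp only [lead]
    omega
  · rw [gen, ← mon_left, co_mon, if_pos ⟨rfl, rfl⟩]
  · rw [gen, ← mon_right, co_mon, if_pos ⟨rfl, rfl⟩]
  · rw [gen, ← mon_left, ← mon_right, map_add, co_mon, co_mon, if_pos ⟨rfl, rfl⟩, if_neg, add_zero]
    simp only [lead]
    omega
  · rw [gen, ← mon_left, ← mon_right, map_sub, co_mon, co_mon, if_pos ⟨rfl, rfl⟩, if_neg, sub_zero]
    simp only [lead]
    omega

/-- The third alternative is needed for `jac`: powers of `x₁ x₂` also have weight `0` and may have
degree at most `e`. Antisymmetry removes them in `eq_zero_of_lead`. -/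
lemma eq_lead_of_add_le {c : Label e} {a b : ℕ} (h : (e : ℤ) ∣ a - b - wt c)
    (hd : a + b ≤ deg c) : lead c = (a, b) ∨ sg c ≠ 0 ∧ lead c = (b, a) ∨ sg c = -1 ∧ a = b := by
  rcases c with _ | _ | ⟨i, hi, hi'⟩ | ⟨i, hi, hi'⟩ | ⟨i, hi⟩ | ⟨i, hi⟩ <;>
  simp only [wt, deg, lead, sg, Prod.mk.injEq] at h hd ⊢
  · left
    omega
  · by_cases hlt : -(e : ℤ) < a - b - 0 ∧ (a : ℤ) - b - 0 < e
    · have := eq_zero_of_dvd_of_lt h hlt.1 hlt.2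
      exact Or.inr (Or.inr ⟨trivial, by omega⟩)
    · by_cases hab : a = e
      · left
        omega
      · exact Or.inr (Or.inl ⟨by norm_num, by omega⟩)
  · have := eq_zero_of_dvd_of_lt h (by omega) (by omega)
    left
    omega
  · have := eq_zero_of_dvd_of_lt h (by omega) (by omega)
    left
    omega
  all_goals
    by_cases hlt : -(e : ℤ) < a - b - i
    · have := eq_zero_of_dvd_of_lt h hlt (by omega)
      left
      omega
    · exact Or.inr (Or.inl ⟨by norm_num, by omega⟩)

lemma eq_zero_of_lead {c : Label e} {f : Poly 2} (hf : f ∈ isoComp c)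
    (hd : ∀ a b, co a b f ≠ 0 → a + b ≤ deg c) (h0 : co (lead c).1 (lead c).2 f = 0) : f = 0 := by
  refine ext_co fun a b => ?_
  rw [map_zero]
  by_contra hne
  rcases eq_lead_of_add_le (hf.1 a b hne) (hd a b hne) with h | ⟨hs, h⟩ | ⟨hs, h⟩
  · rw [h] at h0
    exact hne h0
  · rw [h, co_swap_of_mem hf hs a b] at h0
    exact hne ((mul_eq_zero.1 h0).resolve_left hs)
  · have h1 := co_swap_of_mem hf (by rw [hs]; norm_num) a b
    rw [hs, h] at h1
    rw [h] at hne
    exact hne (by linear_combination h1 / 2)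

/-- The generator spans the part of lowest degree of the isotypic component. -/
lemma eq_smul_gen (he : 1 ≤ e) {c : Label e} {f : Poly 2} (hf : f ∈ isoComp c)
    (hd : ∀ a b, co a b f ≠ 0 → a + b ≤ deg c) :
    f = co (lead c).1 (lead c).2 f • gen c := by
  rw [← sub_eq_zero]
  refine eq_zero_of_lead (sub_mem hf (Submodule.smul_mem _ _ (gen_mem c))) (fun a b hab => ?_) ?_
  · by_cases h : co a b f = 0
    · rw [map_sub, h, zero_sub, neg_ne_zero, map_smul] at hab
      exact (add_eq_deg (right_ne_zero_of_mul hab)).le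
    · exact hd a b h
  · rw [map_sub, map_smul, co_lead_gen he, smul_eq_mul, mul_one, sub_self]

lemma add_le_totalDegree {f : Poly 2} {a b : ℕ} (h : co a b f ≠ 0) : a + b ≤ f.totalDegree := by
  have h1 := le_totalDegree (mem_support_iff.2 h)
  rw [Finsupp.sum_fintype _ _ (fun _ => rfl), Fin.sum_univ_two, expo_zero, expo_one] at h1
  exact h1

/-- A coefficient operator maps a given element of an isotypic component to a given element. -/
lemma exists_coeffOp_eq {c : Label e} {f g : Poly 2} (hf : f ∈ isoComp c) (hg : g ∈ isoComp c)
    {a b : ℕ} (hab : co a b f ≠ 0) {N : ℕ} (hN : f.totalDegree ≤ N) :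
    ∃ r : ℂ, r ≠ 0 ∧ coeffOp N a b g f = r • g := by
  have h := coeffOp_eq (N := N) (a := a) (b := b) (f := f) g
    (fun p q hpq => by have := add_le_totalDegree hpq; omega)
  have hfac : ((a.factorial * b.factorial : ℕ) : ℂ) ≠ 0 := by
    exact_mod_cast (Nat.mul_pos a.factorial_pos b.factorial_pos).ne'
  -- Without sign, the mirror coefficient vanishes and one term of `coeffOp` survives; with a sign,
  -- the two terms are equal and add up.
  by_cases hs : sg c = 0
  · refine ⟨_ * co a b f, mul_ne_zero hfac hab, ?_⟩
    rw [h, co_swap_eq_zero hf hs (hf.1 a b hab), zero_smul, add_zero, smul_smul]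
  · refine ⟨_ * (2 * co a b f), mul_ne_zero hfac (mul_ne_zero two_ne_zero hab), ?_⟩
    rw [h, co_swap_of_mem hf hs a b, hg.2 hs, smul_smul, mul_right_comm, sg_mul_self hs, one_mul,
      ← two_smul ℂ (co a b f • g), smul_smul, smul_smul, mul_assoc]

lemma mem_weightSpace_of_co_ne_zero {c : Label e} {f g : Poly 2} (hf : f ∈ isoComp c)
    (hg : g ∈ isoComp c) {a b : ℕ} (hab : co a b f ≠ 0) : g ∈ weightSpace e ((a : ℤ) - b) := by
  rw [weightSpace_congr (hf.1 a b hab)]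
  exact hg.1

/-! ### The modules over the ring of invariant operators -/

/-- An invariant differential operator, as an element of `𝒟₂`. -/
def opD (P : Module.End ℂ (Poly 2)) (hP : P ∈ invDiffOp (dihedral e)) : D₂ e := ⟨P, hP⟩

lemma smul_eq_opD (P : D₂ e) : ∃ (Q : Module.End ℂ (Poly 2)) (hQ : Q ∈ invDiffOp (dihedral e)),
    P = opD Q hQ := ⟨P.1, P.2, rfl⟩

lemma apply_mem {N : Submodule (D₂ e) (Poly 2)} {P : Module.End ℂ (Poly 2)}
    (hP : P ∈ invDiffOp (dihedral e)) {f : Poly 2} (hf : f ∈ N) : P f ∈ N :=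
  N.smul_mem (opD P hP) hf

lemma smul_mem_complex {N : Submodule (D₂ e) (Poly 2)} (r : ℂ) {f : Poly 2} (hf : f ∈ N) :
    r • f ∈ N :=
  apply_mem (P := algebraMap ℂ _ r) ((invDiffOp (dihedral e)).algebraMap_mem r) hf

lemma mem_of_smul_mem {N : Submodule (D₂ e) (Poly 2)} {r : ℂ} (hr : r ≠ 0) {f : Poly 2}
    (hf : r • f ∈ N) : f ∈ N := by
  have h := smul_mem_complex r⁻¹ hf
  rwa [smul_smul, inv_mul_cancel₀ hr, one_smul] at h

lemma apply_rotEnd {P : Module.End ℂ (Poly 2)} (hP : P ∈ invDiffOp (dihedral e)) (f : Poly 2) :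
    P (rotEnd e f) = rotEnd e (P f) :=
  (LinearMap.congr_fun ((Subalgebra.mem_centralizer_iff ℂ).1 hP.2 _
    ⟨⟨rot e, rot_mem e⟩, rfl⟩) f).symm

lemma apply_swapEnd {P : Module.End ℂ (Poly 2)} (hP : P ∈ invDiffOp (dihedral e)) (f : Poly 2) :
    P (swapEnd f) = swapEnd (P f) :=
  (LinearMap.congr_fun ((Subalgebra.mem_centralizer_iff ℂ).1 hP.2 _
    ⟨⟨swap, swap_mem e⟩, rfl⟩) f).symm

lemma apply_mem_isoComp (he : 1 ≤ e) {P : Module.End ℂ (Poly 2)}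
    (hP : P ∈ invDiffOp (dihedral e)) {c : Label e} {f : Poly 2} (hf : f ∈ isoComp c) :
    P f ∈ isoComp c := by
  refine ⟨?_, fun h => ?_⟩
  · rw [mem_weightSpace_iff he, ← apply_rotEnd hP, (mem_weightSpace_iff he).1 hf.1, map_smul]
  · rw [← apply_swapEnd hP, hf.2 h, map_smul]

/-- A nonzero element of an isotypic component generates it. -/
lemma isoComp_le_of_mem (he : 1 ≤ e) {c : Label e} {f g : Poly 2} (hf : f ∈ isoComp c)
    (hg : g ∈ isoComp c) (hf0 : f ≠ 0) {N : Submodule (D₂ e) (Poly 2)} (hN : f ∈ N) : g ∈ N := by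
  obtain ⟨a, b, hab⟩ := exists_co_ne_zero hf0
  obtain ⟨r, hr, h⟩ := exists_coeffOp_eq hf hg hab le_rfl
  refine mem_of_smul_mem hr ?_
  rw [← h]
  exact apply_mem (coeffOp_mem he _ _ _ (mem_weightSpace_of_co_ne_zero hf hg hab)) hN

lemma mem_M (he : 1 ≤ e) {c : Label e} {f : Poly 2} : f ∈ M c ↔ f ∈ isoComp c := by
  refine ⟨fun h => ?_, fun h => isoComp_le_of_mem he (gen_mem c) h (gen_ne_zero he c)
    (Submodule.mem_span_singleton_self _)⟩
  obtain ⟨P, rfl⟩ := Submodule.mem_span_singleton.1 h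
  obtain ⟨Q, hQ, rfl⟩ := smul_eq_opD P
  exact apply_mem_isoComp he hQ (gen_mem c)

lemma gen_mem_M (c : Label e) : gen c ∈ M c := Submodule.mem_span_singleton_self _

lemma M_le_of_mem (he : 1 ≤ e) {c : Label e} {f : Poly 2} (hf : f ∈ M c) (hf0 : f ≠ 0)
    {N : Submodule (D₂ e) (Poly 2)} (hN : f ∈ N) : M c ≤ N := fun _ hg =>
  isoComp_le_of_mem he ((mem_M he).1 hf) ((mem_M he).1 hg) hf0 hN

lemma isSimpleModule_M (he : 1 ≤ e) (c : Label e) : IsSimpleModule (D₂ e) (M c) := by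
  rw [isSimpleModule_iff_isAtom]
  refine ⟨fun h => gen_ne_zero he c ?_, fun N hN => ?_⟩
  · have := gen_mem_M c
    rwa [h, Submodule.mem_bot] at this
  · by_contra h0
    obtain ⟨f, hf, hf0⟩ := Submodule.exists_mem_ne_zero_of_ne_bot h0
    exact hN.not_ge (M_le_of_mem he (hN.le hf) hf0 hf)

lemma iSup_le_coComp (he : 1 ≤ e) (c : Label e) {f : Poly 2}
    (hf : f ∈ ⨆ (c' : Label e) (_ : c' ≠ c), M c') : f ∈ coComp c := by
  rw [iSup_subtype'] at hf
  refine Submodule.iSup_induction _ (motive := fun f => f ∈ coComp c) hf ?_ (zero_mem _)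
    fun _ _ => add_mem
  exact fun c' g hg => isoComp_le_coComp he c'.2 ((mem_M he).1 hg)

lemma iSupIndep_M (he : 1 ≤ e) : iSupIndep fun c : Label e => M c := by
  intro c
  rw [Submodule.disjoint_def]
  exact fun f hf hf' =>
    eq_zero_of_mem_isoComp_coComp ((mem_M he).1 hf) (iSup_le_coComp he c hf')

/-- Every weight is the weight of a label; it occurs with both signs if it is its own inverse. -/
lemma exists_label_of_weight (he : 1 ≤ e) (w : ℤ) :
    (∃ c c' : Label e, sg c = 1 ∧ sg c' = -1 ∧ (e : ℤ) ∣ w - wt c ∧ wt c' = wt c) ∨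
      ∃ c : Label e, sg c = 0 ∧ (e : ℤ) ∣ w - wt c := by
  have he' : (0 : ℤ) < e := by exact_mod_cast he
  obtain ⟨j, hj⟩ : ∃ j : ℕ, (j : ℤ) = w % e :=
    ⟨(w % e).toNat, Int.toNat_of_nonneg (Int.emod_nonneg _ he'.ne')⟩
  have hlt : j < e := by
    have := Int.emod_lt_of_pos w he'
    omega
  have hd : (e : ℤ) ∣ w - j := by
    rw [hj]
    exact Int.dvd_self_sub_emod
  rcases Nat.eq_zero_or_pos j with rfl | hj0
  · exact Or.inl ⟨.zero, .jac, rfl, rfl, hd, rfl⟩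
  rcases lt_trichotomy (2 * j) e with h | h | h
  · exact Or.inr ⟨.pow₁ j hj0 h, rfl, hd⟩
  · exact Or.inl ⟨.I j h.symm, .II j h.symm, rfl, rfl, hd, rfl⟩
  -- A residue `j > e/2` is represented by the negative weight `-(e - j)`.
  · refine Or.inr ⟨.pow₂ (e - j) (by omega) (by omega), rfl, ?_⟩
    simp only [wt]
    rw [show w - -((e - j : ℕ) : ℤ) = (w - j) + e by omega]
    exact dvd_add hd dvd_rfl

lemma iSup_M (he : 1 ≤ e) : ⨆ c : Label e, M c = ⊤ := by
  set U : Submodule (D₂ e) (Poly 2) := ⨆ c : Label e, M c with hU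
  have hmem : ∀ (c : Label e) (f : Poly 2), f ∈ isoComp c → f ∈ U := fun c f hf =>
    (le_iSup (fun c : Label e => M c) c) ((mem_M he).2 hf)
  -- The same set viewed as a complex subspace, so that monomials suffice.
  let U' : Submodule ℂ (Poly 2) :=
    { carrier := U
      zero_mem' := U.zero_mem
      add_mem' := U.add_mem
      smul_mem' := fun r _ hf => smul_mem_complex r hf }
  rw [eq_top_iff]
  intro f _
  suffices h : f ∈ U' from h
  refine mem_of_mon fun a b _ => ?_
  change mon a b ∈ U
  have hsplit : ∀ c c' : Label e, sg c = 1 → sg c' = -1 → (e : ℤ) ∣ a - b - wt c →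
      wt c' = wt c → mon a b ∈ U := by
    intro c c' hs hs' hw hw'
    have hw2 : (e : ℤ) ∣ b - a - wt c := by
      rw [show (b : ℤ) - a - wt c = -((a - b - wt c) + 2 * wt c) by ring, dvd_neg]
      exact dvd_add hw (dvd_two_wt (by rw [hs]; norm_num))
    have h1 : mon a b + mon b a ∈ U := by
      refine hmem c _ ⟨add_mem (mon_mem_weightSpace hw) (mon_mem_weightSpace hw2), fun _ => ?_⟩
      rw [map_add, swapEnd_mon, swapEnd_mon, hs, one_smul, add_comm]
    have h2 : mon a b - mon b a ∈ U := by
      refine hmem c' _ ⟨?_, fun _ => ?_⟩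
      · rw [hw']
        exact sub_mem (mon_mem_weightSpace hw) (mon_mem_weightSpace hw2)
      · rw [map_sub, swapEnd_mon, swapEnd_mon, hs', neg_one_smul, neg_sub]
    -- Twice the monomial is the sum of its symmetric and antisymmetric parts.
    refine mem_of_smul_mem (two_ne_zero (α := ℂ)) ?_
    convert U.add_mem h1 h2 using 1
    rw [two_smul]
    abel
  rcases exists_label_of_weight he ((a : ℤ) - b) with ⟨c, c', hs, hs', hw, hw'⟩ | ⟨c, hs, hw⟩
  · exact hsplit c c' hs hs' hw hw'
  · exact hmem c _ ⟨mon_mem_weightSpace hw, fun h => absurd hs h⟩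

/-! ### The modules over the invariant ring -/

lemma mem_inv_of_mem_isoComp (he : 1 ≤ e) {f : Poly 2} (hf : f ∈ isoComp (.zero : Label e)) :
    f ∈ A₂ e := by
  refine mem_inv_iff.2 ⟨?_, ?_⟩
  · simpa [wt] using (mem_weightSpace_iff he).1 hf.1
  · simpa [sg] using hf.2 (by simp [sg])

lemma inv_mul_mem_isoComp (he : 1 ≤ e) {c : Label e} {a f : Poly 2} (ha : a ∈ A₂ e)
    (hf : f ∈ isoComp c) : a * f ∈ isoComp c :=
  ⟨mul_mem_weightSpace he ha hf.1, fun h => by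
    rw [swapEnd_mul, swapEnd_of_mem_inv ha, hf.2 h, mul_smul_comm]⟩

lemma genA_subset (c : Label e) : genA c ⊆ isoComp c := by
  have h1 : ∀ (i : ℕ) (j : ℤ), (e : ℤ) ∣ i - j → x₁ ^ i ∈ weightSpace e j := by
    intro i j h
    rw [← mon_left]
    exact mon_mem_weightSpace (by simpa using h)
  have h2 : ∀ (i : ℕ) (j : ℤ), (e : ℤ) ∣ -i - j → x₂ ^ i ∈ weightSpace e j := by
    intro i j h
    rw [← mon_right]
    exact mon_mem_weightSpace (by simpa using h)
  intro f hf
  have hg := gen_mem c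
  rcases c with _ | _ | ⟨i, hi, hi'⟩ | ⟨i, hi, hi'⟩ | ⟨i, hi⟩ | ⟨i, hi⟩
  · exact hf ▸ hg
  · exact hf ▸ hg
  · rcases hf with rfl | rfl
    · exact hg
    · exact ⟨h2 _ _ ⟨-1, by simp only [wt]; omega⟩, by simp [sg]⟩
  · rcases hf with rfl | rfl
    · exact hg
    · exact ⟨h1 _ _ ⟨1, by simp only [wt]; omega⟩, by simp [sg]⟩
  · exact hf ▸ hg
  · exact hf ▸ hg

lemma eq_half_smul {f g : Poly 2} (h : f + f = g) : f = (1 / 2 : ℂ) • g := by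
  rw [← h]
  module

/-- Without sign this is the generation of a weight space by two powers. For `jac`, `I` and `II`,
averaging that expression with `± swapEnd f` merges the two generators into one; for `zero` the
element is itself an invariant. -/
lemma isoComp_le_span (he : 1 ≤ e) {c : Label e} {f : Poly 2} (hf : f ∈ isoComp c) :
    f ∈ Submodule.span (A₂ e) (genA c) := by
  set U := Submodule.span (A₂ e) (genA c) with hU
  have hmul : ∀ a ∈ A₂ e, ∀ g ∈ genA c, a * g ∈ U := fun a ha g hg =>
    U.smul_mem (⟨a, ha⟩ : A₂ e) (Submodule.subset_span hg)
  have hle := basicInv_le e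
  have hswap : ∀ j : ℕ, ∀ a ∈ basicInv e, ∀ a' ∈ basicInv e,
      f = a * x₁ ^ j + a' * x₂ ^ (e - j) → swapEnd f = a * x₂ ^ j + a' * x₁ ^ (e - j) := by
    intro j a ha a' ha' h
    rw [h, map_add, swapEnd_mul, swapEnd_mul, swapEnd_of_mem_inv (hle ha),
      swapEnd_of_mem_inv (hle ha'), swapEnd_x₁, swapEnd_x₂]
  rcases c with _ | _ | ⟨i, hi, hi'⟩ | ⟨i, hi, hi'⟩ | ⟨i, hi⟩ | ⟨i, hi⟩
  · simpa using hmul f (mem_inv_of_mem_isoComp he hf) 1 rfl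
  · obtain ⟨a, ha, a', ha', h⟩ := weightSpace_le_span (Nat.zero_le e) hf.1
    have h1 := hswap 0 a ha a' ha' h
    rw [hf.2 (by simp [sg]), sg, neg_one_smul] at h1
    have h2 : f = (1 / 2 : ℂ) • (-a' * (x₁ ^ e - x₂ ^ e)) := eq_half_smul (by
      simp only [Nat.sub_zero] at h h1
      linear_combination h - h1)
    rw [h2, ← smul_mul_assoc]
    exact hmul _ ((A₂ e).smul_mem (neg_mem (hle ha')) _) _ rfl
  · obtain ⟨a, ha, a', ha', h⟩ := weightSpace_le_span (by omega : i ≤ e) hf.1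
    rw [h]
    exact U.add_mem (hmul _ (hle ha) _ (by simp [genA])) (hmul _ (hle ha') _ (by simp [genA]))
  · have hf' : f ∈ weightSpace e (e - i : ℕ) := by
      rw [← weightSpace_congr (i := -i)]
      · exact hf.1
      · exact ⟨-1, by omega⟩
    obtain ⟨a, ha, a', ha', h⟩ := weightSpace_le_span (by omega : e - i ≤ e) hf'
    rw [h, Nat.sub_sub_self (by omega)]
    exact U.add_mem (hmul _ (hle ha) _ (by simp [genA])) (hmul _ (hle ha') _ (by simp [genA]))
  · obtain ⟨a, ha, a', ha', h⟩ := weightSpace_le_span (by omega : i ≤ e) hf.1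
    have h1 := hswap i a ha a' ha' h
    rw [hf.2 (by simp [sg]), sg, one_smul] at h1
    have h2 : f = (1 / 2 : ℂ) • ((a + a') * (x₁ ^ i + x₂ ^ i)) := eq_half_smul (by
      rw [show e - i = i by omega] at h h1
      linear_combination h + h1)
    rw [h2, ← smul_mul_assoc]
    exact hmul _ ((A₂ e).smul_mem (add_mem (hle ha) (hle ha')) _) _ rfl
  · obtain ⟨a, ha, a', ha', h⟩ := weightSpace_le_span (by omega : i ≤ e) hf.1
    have h1 := hswap i a ha a' ha' h
    rw [hf.2 (by simp [sg]), sg, neg_one_smul] at h1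
    have h2 : f = (1 / 2 : ℂ) • ((a - a') * (x₁ ^ i - x₂ ^ i)) := eq_half_smul (by
      rw [show e - i = i by omega] at h h1
      linear_combination h - h1)
    rw [h2, ← smul_mul_assoc]
    exact hmul _ ((A₂ e).smul_mem (sub_mem (hle ha) (hle ha')) _) _ rfl

lemma asInvModule_M (he : 1 ≤ e) (c : Label e) :
    asInvModule (dihedral e) (M c) = Submodule.span (A₂ e) (genA c) := by
  refine le_antisymm (fun f hf => isoComp_le_span he ((mem_M he).1 hf)) (Submodule.span_le.2 ?_)
  exact fun f hf => (mem_M he).2 (genA_subset c hf)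

/-! ### Isomorphisms -/

/-- The reflection is an isomorphism of `𝒟₂`-modules from `M c` to `M (flip c)`. -/
def swapEquiv (he : 1 ≤ e) (c : Label e) : M c ≃ₗ[D₂ e] M (flip c) where
  toFun f := ⟨swapEnd f, (mem_M he).2 (swapEnd_mem_isoComp ((mem_M he).1 f.2))⟩
  invFun f := ⟨swapEnd f, by
    have := swapEnd_mem_isoComp ((mem_M he).1 f.2)
    rw [flip_flip] at this
    exact (mem_M he).2 this⟩
  left_inv f := Subtype.ext (swapEnd_swapEnd _)
  right_inv f := Subtype.ext (swapEnd_swapEnd _)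
  map_add' f g := Subtype.ext (map_add _ _ _)
  map_smul' P f := by
    obtain ⟨Q, hQ, rfl⟩ := smul_eq_opD P
    exact Subtype.ext (apply_swapEnd hQ _).symm

/-- An operator that scales `gen c` by `r ≠ 0` also scales its image by `r`. Its values on
polynomials of bounded degree are combinations of `gen c` and its reflection, so if `c'` is neither
`c` nor `flip c` the image is zero. -/
lemma eq_or_eq_flip_of_equiv (he : 1 ≤ e) {c c' : Label e} (θ : M c ≃ₗ[D₂ e] M c') :
    c' = c ∨ c' = flip c := by
  by_contra! hne
  set h : M c' := θ ⟨gen c, gen_mem_M c⟩ with hh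
  obtain ⟨a, b, hab⟩ := exists_co_ne_zero (gen_ne_zero he c)
  -- A single operator must be computed on both `gen c` and its image.
  set N := max (gen c).totalDegree (h : Poly 2).totalDegree with hN
  have hP := coeffOp_mem he N a b (mem_weightSpace_of_co_ne_zero (gen_mem c) (gen_mem c) hab)
  obtain ⟨r, hr, h1⟩ := exists_coeffOp_eq (gen_mem c) (gen_mem c) hab (le_max_left _ _ : _ ≤ N)
  have h2 : coeffOp N a b (gen c) h = r • (h : Poly 2) := by
    have h3 : opD _ hP • (⟨gen c, gen_mem_M c⟩ : M c) =
        opD (algebraMap ℂ _ r) ((invDiffOp (dihedral e)).algebraMap_mem r) •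
          (⟨gen c, gen_mem_M c⟩ : M c) := Subtype.ext h1
    have h4 := congrArg (fun z => (θ z : Poly 2)) h3
    simp only [map_smul] at h4
    exact h4
  have h5 := coeffOp_eq (N := N) (a := a) (b := b) (f := (h : Poly 2)) (gen c)
    (fun p q hpq => by
      have h6 := add_le_totalDegree hpq
      have h7 : (h : Poly 2).totalDegree ≤ N := le_max_right _ _
      omega)
  have h6 : r • (h : Poly 2) ∈ coComp c' := by
    rw [← h2, h5]
    refine Submodule.smul_mem _ _ (add_mem (Submodule.smul_mem _ _ ?_) (Submodule.smul_mem _ _ ?_))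
    · exact isoComp_le_coComp he hne.1.symm (gen_mem c)
    · exact isoComp_le_coComp he hne.2.symm (swapEnd_mem_isoComp (gen_mem c))
  have h7 := eq_zero_of_mem_isoComp_coComp
    (Submodule.smul_mem _ r ((mem_M he).1 h.2)) h6
  have h8 : h = 0 := Subtype.ext ((smul_eq_zero.1 h7).resolve_left hr)
  rw [hh, LinearEquiv.map_eq_zero_iff] at h8
  exact gen_ne_zero he c (congrArg Subtype.val h8)

/-! ### Ranks -/

/-- Independence of two polynomials over the invariant ring. -/
def IndepPair (e : ℕ) (f g : Poly 2) : Prop :=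
  ∀ a ∈ A₂ e, ∀ a' ∈ A₂ e, a * f + a' * g = 0 → a = 0 ∧ a' = 0

lemma IndepPair.linearIndependent {f g : Poly 2} (h : IndepPair e f g) :
    LinearIndependent (A₂ e) ![f, g] := by
  rw [LinearIndependent.pair_iff]
  intro a a' h0
  have := h a a.2 a' a'.2 h0
  exact ⟨Subtype.ext this.1, Subtype.ext this.2⟩

lemma IndepPair.rank_span {f g : Poly 2} (h : IndepPair e f g) :
    Module.rank (A₂ e) (Submodule.span (A₂ e) {f, g}) = 2 := by
  have hr : Set.range ![f, g] = {f, g} := by simp [Set.pair_comm]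
  rw [← hr, _root_.rank_span h.linearIndependent,
    Cardinal.mk_range_eq _ h.linearIndependent.injective]
  simp

lemma IndepPair.two_le_rankA {N : Submodule (D₂ e) (Poly 2)} {f g : Poly 2}
    (h : IndepPair e f g) (hf : f ∈ N) (hg : g ∈ N) : 2 ≤ rankA N := by
  rw [← h.rank_span]
  refine Submodule.rank_mono (Submodule.span_le.2 ?_)
  rintro _ (rfl | rfl)
  · exact hf
  · exact hg

lemma rank_span_singleton_eq_one {f : Poly 2} (hf : f ≠ 0) :
    Module.rank (A₂ e) (Submodule.span (A₂ e) {f}) = 1 := by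
  have hl : LinearIndepOn (A₂ e) id {f} := linearIndepOn_singleton_iff (A₂ e) |>.2 hf
  rw [rank_span_set hl, Cardinal.mk_singleton]

lemma rankA_M_of_sg_ne_zero (he : 1 ≤ e) {c : Label e} (h : sg c ≠ 0) : rankA (M c) = 1 := by
  have hc : genA c = {gen c} := by
    cases c <;> simp_all [genA, gen, sg]
  rw [rankA, asInvModule_M he, hc]
  exact rank_span_singleton_eq_one (gen_ne_zero he c)

lemma exists_indepPair (he : 1 ≤ e) {c : Label e} (h : sg c = 0) :
    ∃ f g, genA c = {f, g} ∧ IndepPair e f g := by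
  rcases c with _ | _ | ⟨i, hi, hi'⟩ | ⟨i, hi, hi'⟩ | ⟨i, hi⟩ | ⟨i, hi⟩
  · simp [sg] at h
  · simp [sg] at h
  · exact ⟨_, _, rfl, fun a ha a' ha' => eq_zero_of_pow he (by omega) ha ha'⟩
  · refine ⟨_, _, rfl, fun a ha a' ha' h0 => ?_⟩
    rw [add_comm] at h0
    exact (eq_zero_of_pow he (by omega) ha' ha h0).symm
  · simp [sg] at h
  · simp [sg] at h

lemma rankA_M_of_sg_eq_zero (he : 1 ≤ e) {c : Label e} (h : sg c = 0) : rankA (M c) = 2 := by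
  obtain ⟨f, g, hfg, hi⟩ := exists_indepPair he h
  rw [rankA, asInvModule_M he, hfg, hi.rank_span]

/-- Two summands from different components of a vanishing sum vanish. -/
lemma eq_zero_of_add_eq_zero (he : 1 ≤ e) {c c' : Label e} (h : c' ≠ c) {f g : Poly 2}
    (hf : f ∈ isoComp c) (hg : g ∈ isoComp c') (h0 : f + g = 0) : f = 0 := by
  refine eq_zero_of_mem_isoComp_coComp hf ?_
  rw [eq_neg_of_add_eq_zero_left h0]
  exact neg_mem (isoComp_le_coComp he h hg)

/-- A nonzero submodule of rank at most one contains one of the modules of rank one. -/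
lemma exists_M_le (he : 1 ≤ e) {N : Submodule (D₂ e) (Poly 2)} (hN : ¬ 2 ≤ rankA N) {f : Poly 2}
    (hf : f ∈ N) (hf0 : f ≠ 0) : ∃ c : Label e, sg c ≠ 0 ∧ M c ≤ N := by
  obtain ⟨a, b, hab⟩ := exists_co_ne_zero hf0
  -- With `f` and the exponents fixed and `g` varying, `N` contains the image of the whole weight
  -- space under `g ↦ α g + β σ g`, where `α ≠ 0`.
  have key : ∀ g ∈ weightSpace e ((a : ℤ) - b), co a b f • g + co b a f • swapEnd g ∈ N := by
    intro g hg
    have h1 := coeffOp_eq (N := f.totalDegree) (a := a) (b := b) (f := f) g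
      (fun p q hpq => by have := add_le_totalDegree hpq; omega)
    have h2 := apply_mem (coeffOp_mem he f.totalDegree a b hg) hf
    rw [h1] at h2
    refine mem_of_smul_mem ?_ h2
    exact_mod_cast (Nat.mul_pos a.factorial_pos b.factorial_pos).ne'
  rcases exists_label_of_weight he ((a : ℤ) - b) with ⟨c, c', hs, hs', hw, hw'⟩ | ⟨c, hs, hw⟩
  · have key' : ∀ d : Label e, wt d = wt c → sg d ≠ 0 → co a b f + co b a f * sg d ≠ 0 →
        ∃ c : Label e, sg c ≠ 0 ∧ M c ≤ N := by
      intro d hd hsd hne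
      have h1 := key (gen d) (by rw [weightSpace_congr hw, ← hd]; exact (gen_mem d).1)
      rw [(gen_mem d).2 hsd, smul_smul, ← add_smul] at h1
      exact ⟨d, hsd, M_le_of_mem he (gen_mem_M d) (gen_ne_zero he d) (mem_of_smul_mem hne h1)⟩
    -- Of `α + β` and `α - β` at least one is nonzero, since `α` is.
    by_cases h : co a b f + co b a f * sg c = 0
    · refine key' c' hw' (by rw [hs']; norm_num) fun h' => hab ?_
      rw [hs] at h
      rw [hs'] at h'
      linear_combination h / 2 + h' / 2
    · exact key' c rfl (by rw [hs]; norm_num) h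
  -- The twisted map is injective, as `α g` and `β σ g` lie in different components, so an
  -- independent pair stays independent and the rank is at least two.
  · exfalso
    obtain ⟨g, g', hg, hi⟩ := exists_indepPair he hs
    have hgm : g ∈ isoComp c := genA_subset c (by simp [hg])
    have hgm' : g' ∈ isoComp c := genA_subset c (by simp [hg])
    have h1 := key g (by rw [weightSpace_congr hw]; exact hgm.1)
    have h2 := key g' (by rw [weightSpace_congr hw]; exact hgm'.1)
    refine hN (IndepPair.two_le_rankA (fun u hu u' hu' h0 => ?_) h1 h2)
    have h3 : co a b f • (u * g + u' * g') + co b a f • (u * swapEnd g + u' * swapEnd g') = 0 := by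
      rw [← h0]
      simp only [smul_add, mul_add, mul_smul_comm]
      abel
    have h4 := eq_zero_of_add_eq_zero he (flip_ne_self hs)
      (Submodule.smul_mem _ _ (add_mem (inv_mul_mem_isoComp he hu hgm)
        (inv_mul_mem_isoComp he hu' hgm')))
      (Submodule.smul_mem _ _ (add_mem (inv_mul_mem_isoComp he hu (swapEnd_mem_isoComp hgm))
        (inv_mul_mem_isoComp he hu' (swapEnd_mem_isoComp hgm')))) h3
    exact hi u hu u' hu' ((smul_eq_zero.1 h4).resolve_left hab)

/-- The submodules of rank one. -/
lemma rankA_eq_one_iff (he : 1 ≤ e) (N : Submodule (D₂ e) (Poly 2)) :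
    rankA N = 1 ↔ ∃ c : Label e, sg c ≠ 0 ∧ N = M c := by
  refine ⟨fun hN => ?_, ?_⟩
  swap
  · rintro ⟨c, hc, rfl⟩
    exact rankA_M_of_sg_ne_zero he hc
  have hlt : rankA N < 2 := by
    rw [hN]
    exact Cardinal.one_lt_two
  have hex : ∃ f ∈ N, f ≠ 0 := by
    by_contra! h0
    have : Subsingleton (asInvModule (dihedral e) N) :=
      ⟨fun f g => Subtype.ext ((h0 f f.2).trans (h0 g g.2).symm)⟩
    rw [rankA, rank_subsingleton'] at hN
    exact zero_ne_one hN
  obtain ⟨f, hf, hf0⟩ := hex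
  obtain ⟨c, hc, hle⟩ := exists_M_le he hlt.not_ge hf hf0
  refine ⟨c, hc, le_antisymm (fun g hg => ?_) hle⟩
  -- If `N` were larger than `M c`, it would meet the complement `Q`; the intersection would contain
  -- a second module of rank one, and the two generators would be independent.
  set Q : Submodule (D₂ e) (Poly 2) := ⨆ (c' : Label e) (_ : c' ≠ c), M c' with hQ
  have htop : g ∈ M c ⊔ Q := by
    rw [hQ, ← iSup_split_single (fun c : Label e => M c) c, iSup_M he]
    trivial
  obtain ⟨u, hu, v, hv, rfl⟩ := Submodule.mem_sup.1 htop
  have hvN : v ∈ N ⊓ Q := ⟨by simpa using N.sub_mem hg (hle hu), hv⟩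
  by_cases hv0 : v = 0
  · rwa [hv0, add_zero]
  exfalso
  obtain ⟨c', hc', hle'⟩ := exists_M_le he (fun h => hlt.not_ge (h.trans
    (Submodule.rank_mono (fun z hz => hz.1 :
      asInvModule (dihedral e) (N ⊓ Q) ≤ asInvModule (dihedral e) N)))) hvN hv0
  have hne : c' ≠ c := by
    rintro rfl
    exact gen_ne_zero he c' (eq_zero_of_mem_isoComp_coComp (gen_mem c')
      (iSup_le_coComp he c' (hle' (gen_mem_M c')).2))
  refine hlt.not_ge (IndepPair.two_le_rankA (fun a ha a' ha' h0 => ?_) (hle (gen_mem_M c))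
    (hle' (gen_mem_M c')).1)
  have h1 := eq_zero_of_add_eq_zero he hne (inv_mul_mem_isoComp he ha (gen_mem c))
    (inv_mul_mem_isoComp he ha' (gen_mem c')) h0
  rw [h1, zero_add] at h0
  exact ⟨(mul_eq_zero.1 h1).resolve_right (gen_ne_zero he c),
    (mul_eq_zero.1 h0).resolve_right (gen_ne_zero he c')⟩

/-! ### Lowest weight spaces -/

lemma mem_invDiffOp_of_mem_negPart {P : Module.End ℂ (Poly 2)} (hP : P ∈ negPart (dihedral e)) :
    P ∈ invDiffOp (dihedral e) :=
  (iSup₂_le fun _ _ _ hR => hR.1 :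
    negPart (dihedral e) ≤ Subalgebra.toSubmodule (invDiffOp (dihedral e))) hP

/-- A homogeneous operator of negative degree lowers the degree but stays in the component, which
has no nonzero element of degree below `deg c`. -/
lemma negPart_gen (he : 1 ≤ e) (c : Label e) {P : Module.End ℂ (Poly 2)}
    (hP : P ∈ negPart (dihedral e)) : P (gen c) = 0 := by
  suffices h : negPart (dihedral e) ≤ LinearMap.ker (LinearMap.applyₗ (R := ℂ) (gen c)) from h hP
  refine iSup₂_le fun k hk R hR => ?_
  rw [LinearMap.mem_ker, LinearMap.applyₗ_apply_apply]
  have h1 := LinearMap.congr_fun hR.2 (gen c)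
  rw [LinearMap.sub_apply, Module.End.mul_apply, Module.End.mul_apply, euler_gen, map_smul,
    LinearMap.smul_apply] at h1
  have hdeg : ∀ a b, co a b (R (gen c)) ≠ 0 → ((a + b : ℕ) : ℤ) = deg c + k := by
    intro a b hab
    have h2 := congrArg (co a b) h1
    rw [map_sub, co_euler, map_smul, map_smul, smul_eq_mul, smul_eq_mul, ← sub_mul] at h2
    have h3 := mul_right_cancel₀ hab h2
    have h4 : ((a + b : ℕ) : ℂ) = deg c + k := by linear_combination h3
    exact_mod_cast h4
  have hmem := apply_mem_isoComp he hR.1 (gen_mem c)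
  refine eq_zero_of_lead hmem (fun a b hab => ?_) ?_
  · have := hdeg a b hab
    omega
  · by_contra hne
    have h2 := hdeg _ _ hne
    have h3 := add_eq_deg (c := c) (a := (lead c).1) (b := (lead c).2)
      (by rw [co_lead_gen he]; exact one_ne_zero)
    omega

lemma mem_ann_M (he : 1 ≤ e) {c : Label e} {f : Poly 2} :
    f ∈ ann (dihedral e) (M c) ↔ ∃ r : ℂ, r • gen c = f := by
  refine ⟨fun hf => ?_, ?_⟩
  · have hm := (mem_M he).1 hf.1
    refine ⟨_, (eq_smul_gen he hm fun a b hab => ?_).symm⟩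
    -- A term of degree above `deg c` makes the operator sending `f` to a multiple of `gen c` one of
    -- negative degree, so it would have to kill `f`.
    by_contra! hlt
    obtain ⟨r, hr, h⟩ := exists_coeffOp_eq hm (gen_mem c) hab le_rfl
    have h1 := coeffOp_mem_degPart he f.totalDegree a b
      (mem_weightSpace_of_co_ne_zero hm (gen_mem c) hab) (euler_gen c)
    rw [hf.2 _ (Submodule.mem_iSup_of_mem _ (Submodule.mem_iSup_of_mem (by omega) h1))] at h
    exact smul_ne_zero hr (gen_ne_zero he c) h.symm
  · rintro ⟨r, rfl⟩
    exact ⟨smul_mem_complex r (gen_mem_M c), fun P hP => by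
      rw [map_smul, negPart_gen he c hP, smul_zero]⟩

lemma coe_ann_M (he : 1 ≤ e) (c : Label e) :
    (ann (dihedral e) (M c) : Set (Poly 2)) = Submodule.span ℂ {gen c} := by
  ext f
  rw [SetLike.mem_coe, SetLike.mem_coe, mem_ann_M he, Submodule.mem_span_singleton]

lemma gen_mem_ann (he : 1 ≤ e) (c : Label e) : gen c ∈ ann (dihedral e) (M c) :=
  (mem_ann_M he).2 ⟨1, one_smul _ _⟩

lemma smul_mem_complex_of_zeroPart {N : Submodule (D₂zero e) (Poly 2)} (r : ℂ) {f : Poly 2}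
    (hf : f ∈ N) : r • f ∈ N :=
  N.smul_mem (⟨algebraMap ℂ _ r, (zeroPart (dihedral e)).algebraMap_mem r⟩ : D₂zero e) hf

lemma isSimpleModule_ann (he : 1 ≤ e) (c : Label e) :
    IsSimpleModule (D₂zero e) (ann (dihedral e) (M c)) := by
  rw [isSimpleModule_iff_isAtom]
  refine ⟨fun h => gen_ne_zero he c ?_, fun N hN => ?_⟩
  · have := gen_mem_ann he c
    rwa [h, Submodule.mem_bot] at this
  · by_contra h0
    obtain ⟨f, hf, hf0⟩ := Submodule.exists_mem_ne_zero_of_ne_bot h0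
    obtain ⟨r, rfl⟩ := (mem_ann_M he).1 (hN.le hf)
    refine hN.not_ge fun g hg => ?_
    obtain ⟨s, rfl⟩ := (mem_ann_M he).1 hg
    have hr : r ≠ 0 := left_ne_zero_of_smul hf0
    have h1 := smul_mem_complex_of_zeroPart (s * r⁻¹) hf
    rwa [smul_smul, inv_mul_cancel_right₀ hr] at h1

lemma iSupIndep_ann (he : 1 ≤ e) : iSupIndep fun c : Label e => ann (dihedral e) (M c) := by
  intro c
  rw [Submodule.disjoint_def]
  intro f hf hf'
  refine eq_zero_of_mem_isoComp_coComp ((mem_M he).1 hf.1) ?_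
  rw [iSup_subtype'] at hf'
  refine Submodule.iSup_induction _ (motive := fun f => f ∈ coComp c) hf' ?_ (zero_mem _)
    fun _ _ => add_mem
  exact fun c' g hg => isoComp_le_coComp he c'.2 ((mem_M he).1 hg.1)

/-- Operators preserve the summands, so by independence `P f = 0` holds for each component of `f`
separately. -/
lemma iSup_ann (he : 1 ≤ e) :
    ⨆ c : Label e, ann (dihedral e) (M c) = ann (dihedral e) ⊤ := by
  classical
  refine le_antisymm (iSup_le fun c f hf => ⟨trivial, hf.2⟩) fun f hf => ?_
  have htop : f ∈ ⨆ c : Label e, M c := by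
    rw [iSup_M he]
    trivial
  obtain ⟨u, hu, rfl⟩ := (Submodule.mem_iSup_iff_exists_finsupp _ _).1 htop
  refine sum_mem fun c _ => ?_
  refine (le_iSup (fun c : Label e => ann (dihedral e) (M c)) c) ⟨hu c, fun P hP => ?_⟩
  have hPD := mem_invDiffOp_of_mem_negPart hP
  by_cases hc : c ∈ u.support
  · refine (iSupIndep_iff_finsetSum_eq_zero_imp_eq_zero _).1 (iSupIndep_M he) u.support
      (fun c => P (u c)) (fun c _ => apply_mem hPD (hu c)) ?_ c hc
    have h1 := hf.2 P hP
    rwa [Finsupp.sum, map_sum] at h1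
  · rw [Finsupp.notMem_support_iff.1 hc, map_zero]

/-! ### The Gelfand model -/

/-- The subspace of `B^ann` spanned by the images of the generator of `M c` under the group. -/
def irrSpace (c : Label e) : Submodule ℂ (Poly 2) := Submodule.span ℂ {gen c, swapEnd (gen c)}

lemma mem_irrSpace {c : Label e} {f : Poly 2} :
    f ∈ irrSpace c ↔ ∃ r s : ℂ, r • gen c + s • swapEnd (gen c) = f := Submodule.mem_span_pair

lemma gen_mem_irrSpace (c : Label e) : gen c ∈ irrSpace c := Submodule.subset_span (by simp)

lemma swapEnd_gen_mem_irrSpace (c : Label e) : swapEnd (gen c) ∈ irrSpace c :=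
  Submodule.subset_span (by simp)

lemma rotEnd_gen (he : 1 ≤ e) (c : Label e) : rotEnd e (gen c) = eps e ^ wt c • gen c :=
  (mem_weightSpace_iff he).1 (gen_mem c).1

lemma rotEnd_swapEnd_gen (he : 1 ≤ e) (c : Label e) :
    rotEnd e (swapEnd (gen c)) = eps e ^ (-wt c) • swapEnd (gen c) :=
  (mem_weightSpace_iff he).1 (swapEnd_mem_weightSpace (gen_mem c).1)

lemma rotEnd_mem_irrSpace (he : 1 ≤ e) {c : Label e} {f : Poly 2} (hf : f ∈ irrSpace c) :
    rotEnd e f ∈ irrSpace c := by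
  obtain ⟨r, s, rfl⟩ := mem_irrSpace.1 hf
  rw [map_add, map_smul, map_smul, rotEnd_gen he, rotEnd_swapEnd_gen he]
  exact add_mem (Submodule.smul_mem _ _ (Submodule.smul_mem _ _ (gen_mem_irrSpace c)))
    (Submodule.smul_mem _ _ (Submodule.smul_mem _ _ (swapEnd_gen_mem_irrSpace c)))

lemma swapEnd_mem_irrSpace {c : Label e} {f : Poly 2} (hf : f ∈ irrSpace c) :
    swapEnd f ∈ irrSpace c := by
  obtain ⟨r, s, rfl⟩ := mem_irrSpace.1 hf
  rw [map_add, map_smul, map_smul, swapEnd_swapEnd]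
  exact add_mem (Submodule.smul_mem _ _ (swapEnd_gen_mem_irrSpace c))
    (Submodule.smul_mem _ _ (gen_mem_irrSpace c))

lemma irrSpace_le_annRep (he : 1 ≤ e) (c : Label e) :
    irrSpace c ≤ (annRep (dihedral e)).toSubmodule := by
  have h : gen c ∈ (annRep (dihedral e)).toSubmodule := ⟨trivial, (gen_mem_ann he c).2⟩
  refine Submodule.span_le.2 ?_
  rintro _ (rfl | rfl)
  · exact h
  · exact (annRep (dihedral e)).apply_mem_toSubmodule ⟨swap, swap_mem e⟩ h

/-- A stable subspace that contains a nonzero element of `irrSpace c` contains the generator. -/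
lemma gen_mem_of_stable (he : 1 ≤ e) {c : Label e} {Z : Submodule ℂ (Poly 2)}
    (hr : ∀ f ∈ Z, rotEnd e f ∈ Z) (hs : ∀ f ∈ Z, swapEnd f ∈ Z) {f : Poly 2}
    (hf : f ∈ irrSpace c) (hf0 : f ≠ 0) (hZ : f ∈ Z) : gen c ∈ Z := by
  obtain ⟨r, s, rfl⟩ := mem_irrSpace.1 hf
  have hsmul : ∀ t : ℂ, t ≠ 0 → t • gen c ∈ Z → gen c ∈ Z := fun t ht h => by
    have := Z.smul_mem t⁻¹ h
    rwa [smul_smul, inv_mul_cancel₀ ht, one_smul] at this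
  by_cases h : sg c = 0
  · by_cases hr0 : r = 0
    · rw [hr0, zero_smul, zero_add] at hf0 hZ
      refine hsmul s (left_ne_zero_of_smul hf0) ?_
      have := hs _ hZ
      rwa [map_smul, swapEnd_swapEnd] at this
    -- This difference kills the reflected generator and scales `gen c` by a nonzero factor, because
    -- the two weights are not congruent.
    · have h1 := Z.sub_mem (hr _ hZ) (Z.smul_mem (eps e ^ (-wt c)) hZ)
      rw [map_add, map_smul, map_smul, rotEnd_gen he, rotEnd_swapEnd_gen he] at h1
      refine hsmul (r * (eps e ^ wt c - eps e ^ (-wt c))) (mul_ne_zero hr0 ?_) ?_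
      · rw [sub_ne_zero]
        intro h2
        refine not_dvd_two_wt h ?_
        have := (eps_zpow_eq he).1 h2
        rwa [sub_neg_eq_add, ← two_mul] at this
      · convert h1 using 1
        module
  · rw [(gen_mem c).2 h, smul_smul, ← add_smul] at hf0 hZ
    exact hsmul _ (left_ne_zero_of_smul hf0) hZ

lemma irrSpace_le_coComp (he : 1 ≤ e) {c c' : Label e} (h : c' ≠ c) (h' : c' ≠ flip c) :
    irrSpace c' ≤ coComp c := by
  refine Submodule.span_le.2 ?_
  rintro _ (rfl | rfl)
  · exact isoComp_le_coComp he h (gen_mem c')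
  · refine isoComp_le_coComp he (fun h'' => h' ?_) (swapEnd_mem_isoComp (gen_mem c'))
    rw [← h'', flip_flip]

lemma eq_zero_of_mem_irrSpace (he : 1 ≤ e) {c : Label e} {f : Poly 2} (hf : f ∈ irrSpace c)
    (h1 : f ∈ coComp c) (h2 : f ∈ coComp (flip c)) : f = 0 := by
  obtain ⟨r, s, rfl⟩ := mem_irrSpace.1 hf
  have hm := (isoComp c).smul_mem r (gen_mem c)
  have hm' := (isoComp (flip c)).smul_mem s (swapEnd_mem_isoComp (gen_mem c))
  by_cases h : sg c = 0
  · have h3 : r • gen c = 0 := by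
      refine eq_zero_of_mem_isoComp_coComp hm ?_
      have := sub_mem h1 (isoComp_le_coComp he (flip_ne_self h) hm')
      rwa [add_sub_cancel_right] at this
    rw [h3, zero_add] at h2 ⊢
    exact eq_zero_of_mem_isoComp_coComp hm' h2
  · rw [flip_eq_self h] at hm'
    exact eq_zero_of_mem_isoComp_coComp (add_mem hm hm') h1

/-- Labels of the irreducible representations. -/
def IrrLabel (e : ℕ) : Type := {c : Label e // 0 ≤ wt c}

/-- Only the `pow₂` labels have negative weight, so nonnegativity picks one label from each mirror
pair. -/
lemma IrrLabel.ne_flip {c c' : IrrLabel e} (h : c' ≠ c) : c'.1 ≠ flip c.1 := by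
  intro h'
  obtain ⟨c, hc⟩ := c
  obtain ⟨c', hc'⟩ := c'
  simp only at h'
  subst h'
  cases c <;> simp only [flip, wt] at h hc hc'
  case pow₁ => omega
  case pow₂ => omega
  all_goals exact h rfl

lemma exists_irrLabel (c : Label e) : ∃ d : IrrLabel e, gen c ∈ irrSpace d.1 := by
  by_cases hc : 0 ≤ wt c
  · exact ⟨⟨c, hc⟩, gen_mem_irrSpace c⟩
  · rcases c with _ | _ | ⟨i, hi, hi'⟩ | ⟨i, hi, hi'⟩ | ⟨i, hi⟩ | ⟨i, hi⟩ <;>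
    first
    | (simp [wt] at hc; done)
    | skip
    refine ⟨⟨.pow₁ i hi hi', by simp [wt]⟩, ?_⟩
    have := swapEnd_gen_mem_irrSpace (.pow₁ i hi hi')
    rwa [gen, swapEnd_x₁] at this

/-- The irreducible subrepresentations of `B^ann`. -/
def irrRep (he : 1 ≤ e) (c : Label e) :
    Subrepresentation (annRep (dihedral e)).toRepresentation where
  toSubmodule := (irrSpace c).comap (annRep (dihedral e)).toSubmodule.subtype
  apply_mem_toSubmodule g v hv := by
    refine stable_of_generators he _ _ (fun u hu => ?_) (fun u hu => ?_) g v hv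
    · exact rotEnd_mem_irrSpace he hu
    · exact swapEnd_mem_irrSpace hu

/-- An element of `irrSpace c`, as an element of the corresponding representation. -/
def toIrrRep (he : 1 ≤ e) {c : Label e} (f : Poly 2) (hf : f ∈ irrSpace c) :
    (irrRep he c).toSubmodule := ⟨⟨f, irrSpace_le_annRep he c hf⟩, hf⟩

lemma irrRep_isIrreducible (he : 1 ≤ e) (c : Label e) :
    Representation.IsIrreducible (k := ℂ) (V := (irrRep he c).toSubmodule)
      (irrRep he c).toRepresentation := by
  have hbot : ∀ S : Subrepresentation (irrRep he c).toRepresentation, S ≠ ⊥ → S = ⊤ := by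
    intro S hS
    -- The subrepresentation is transported to `B`, where `gen_mem_of_stable` applies.
    let ι : (irrRep he c).toSubmodule →ₗ[ℂ] Poly 2 :=
      (annRep (dihedral e)).toSubmodule.subtype.comp (irrRep he c).toSubmodule.subtype
    have hι : Function.Injective ι := Subtype.val_injective.comp Subtype.val_injective
    have hZr : ∀ f ∈ S.toSubmodule.map ι, rotEnd e f ∈ S.toSubmodule.map ι := by
      rintro _ ⟨v, hv, rfl⟩
      exact ⟨_, S.apply_mem_toSubmodule ⟨rot e, rot_mem e⟩ hv, rfl⟩
    have hZs : ∀ f ∈ S.toSubmodule.map ι, swapEnd f ∈ S.toSubmodule.map ι := by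
      rintro _ ⟨v, hv, rfl⟩
      exact ⟨_, S.apply_mem_toSubmodule ⟨swap, swap_mem e⟩ hv, rfl⟩
    obtain ⟨v, hv, hv0⟩ := Submodule.exists_mem_ne_zero_of_ne_bot
      (fun h => hS (Subrepresentation.toSubmodule_injective h) : S.toSubmodule ≠ ⊥)
    have hg := gen_mem_of_stable he hZr hZs v.2
      (fun h => hv0 (hι (h.trans (map_zero ι).symm))) ⟨v, hv, rfl⟩
    refine Subrepresentation.toSubmodule_injective (eq_top_iff.2 fun u _ => ?_)
    have hu : ι u ∈ S.toSubmodule.map ι := by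
      have hle : irrSpace c ≤ S.toSubmodule.map ι := by
        refine Submodule.span_le.2 ?_
        rintro _ (rfl | rfl)
        · exact hg
        · exact hZs _ hg
      exact hle u.2
    obtain ⟨u', hu', h⟩ := hu
    rwa [hι h] at hu'
  have hne : (⊥ : Subrepresentation (irrRep he c).toRepresentation) ≠ ⊤ := by
    intro h
    have h1 : toIrrRep he (gen c) (gen_mem_irrSpace c) ∈
        (⊤ : Subrepresentation (irrRep he c).toRepresentation).toSubmodule := Submodule.mem_top
    rw [← h] at h1
    have h2 := (Submodule.mem_bot ℂ).1 h1
    exact gen_ne_zero he c (congrArg (fun v => (v.1.1 : Poly 2)) h2)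
  exact
    { exists_pair_ne := ⟨⊥, ⊤, hne⟩
      eq_bot_or_eq_top := fun S => or_iff_not_imp_left.2 (hbot S) }

/-- An equivalence preserves the weight and sign of `gen c`, so its image lies in `isoComp c`; for
`c' ≠ c` the target lies in `coComp c`. -/
lemma irrRep_not_equiv (he : 1 ≤ e) {c c' : IrrLabel e}
    (θ : (irrRep he c.1).toRepresentation.Equiv (irrRep he c'.1).toRepresentation) : c = c' := by
  by_contra hne
  set v := toIrrRep he (gen c.1) (gen_mem_irrSpace c.1) with hv
  have hrot : (irrRep he c.1).toRepresentation ⟨rot e, rot_mem e⟩ v = eps e ^ wt c.1 • v :=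
    Subtype.ext (Subtype.ext (rotEnd_gen he c.1))
  have hswap : sg c.1 ≠ 0 →
      (irrRep he c.1).toRepresentation ⟨swap, swap_mem e⟩ v = sg c.1 • v := fun h =>
    Subtype.ext (Subtype.ext ((gen_mem c.1).2 h))
  have hθ : ∀ g u, θ ((irrRep he c.1).toRepresentation g u) =
      (irrRep he c'.1).toRepresentation g (θ u) := fun g u =>
    Representation.IntertwiningMap.isIntertwining _ _ θ.toIntertwiningMap g u
  have hm : ((θ v).1.1 : Poly 2) ∈ isoComp c.1 := by
    refine ⟨(mem_weightSpace_iff he).2 ?_, fun h => ?_⟩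
    · have h1 := hθ ⟨rot e, rot_mem e⟩ v
      rw [hrot, map_smul] at h1
      exact (congrArg (fun u => (u.1.1 : Poly 2)) h1).symm
    · have h1 := hθ ⟨swap, swap_mem e⟩ v
      rw [hswap h, map_smul] at h1
      exact (congrArg (fun u => (u.1.1 : Poly 2)) h1).symm
  have h0 : ((θ v).1.1 : Poly 2) = 0 := eq_zero_of_mem_isoComp_coComp hm
    (irrSpace_le_coComp he (fun h => hne (Subtype.ext h.symm)) (IrrLabel.ne_flip (Ne.symm hne))
      (θ v).2)
  have h1 : θ v = 0 := Subtype.ext (Subtype.ext h0)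
  have h2 : v = 0 := by
    have := θ.symm_apply_apply v
    rw [h1, map_zero] at this
    exact this.symm
  exact gen_ne_zero he c.1 (congrArg (fun v => (v.1.1 : Poly 2)) h2)

lemma iSupIndep_irrRep (he : 1 ≤ e) :
    iSupIndep fun c : IrrLabel e => (irrRep he c.1).toSubmodule := by
  intro c
  rw [Submodule.disjoint_def]
  intro v hv hv'
  have hle : ⨆ (c' : IrrLabel e) (_ : c' ≠ c), (irrRep he c'.1).toSubmodule ≤
      (coComp c.1 ⊓ coComp (flip c.1)).comap (annRep (dihedral e)).toSubmodule.subtype := by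
    refine iSup₂_le fun c' hc' u hu => ?_
    have h1 : c'.1 ≠ c.1 := fun h => hc' (Subtype.ext h)
    have h2 := IrrLabel.ne_flip hc'
    exact ⟨irrSpace_le_coComp he h1 h2 hu,
      irrSpace_le_coComp he h2 (by rwa [flip_flip]) hu⟩
  have h := hle hv'
  exact Subtype.ext (eq_zero_of_mem_irrSpace he hv h.1 h.2)

lemma iSup_irrRep (he : 1 ≤ e) :
    ⨆ c : IrrLabel e, (irrRep he c.1).toSubmodule = ⊤ := by
  rw [eq_top_iff]
  intro v _
  have hv : (v : Poly 2) ∈ ⨆ c : Label e, ann (dihedral e) (M c) := by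
    rw [iSup_ann he]
    exact v.2
  have h : (v : Poly 2) ∈ (⨆ c : IrrLabel e, (irrRep he c.1).toSubmodule).map
      (annRep (dihedral e)).toSubmodule.subtype := by
    refine Submodule.iSup_induction _ (motive := fun f => f ∈ (⨆ c : IrrLabel e,
      (irrRep he c.1).toSubmodule).map (annRep (dihedral e)).toSubmodule.subtype) hv ?_
      (zero_mem _) fun _ _ => add_mem
    intro c f hf
    obtain ⟨r, rfl⟩ := (mem_ann_M he).1 hf
    obtain ⟨d, hd⟩ := exists_irrLabel c
    refine Submodule.smul_mem _ r ⟨⟨gen c, irrSpace_le_annRep he _ hd⟩, ?_, rfl⟩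
    exact (le_iSup (fun c : IrrLabel e => (irrRep he c.1).toSubmodule) d) hd
  obtain ⟨u, hu, huv⟩ := h
  rwa [← Subtype.ext huv]

/-- Every nontrivial representation contains an eigenvector of the rotation. -/
lemma exists_eigenvector (he : 1 ≤ e) {T : Type*} [AddCommGroup T] [Module ℂ T] [Nontrivial T]
    (τ : Representation ℂ (dihedral e) T) :
    ∃ (i : ℤ) (w : T), w ≠ 0 ∧ τ ⟨rot e, rot_mem e⟩ w = eps e ^ i • w := by
  set r := τ ⟨rot e, rot_mem e⟩ with hr
  have hre : r ^ e = 1 := by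
    rw [hr, ← map_pow, show (⟨rot e, rot_mem e⟩ : dihedral e) ^ e = 1 from
      Subtype.ext (rot_pow he), map_one]
  -- The product of all `r - z` over the `e`-th roots of unity is zero, so some factor is not
  -- injective. This avoids assuming finite dimension.
  have hprod := congrArg (Polynomial.aeval r) (Polynomial.X_pow_sub_one_eq_prod he (eps_primitive he))
  rw [map_sub, map_pow, Polynomial.aeval_X, map_one, hre, sub_self] at hprod
  have hex : ∃ z ∈ Polynomial.nthRootsFinset e (1 : ℂ),
      ¬ Function.Injective (Polynomial.aeval r (Polynomial.X - Polynomial.C z)) := by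
    by_contra! hinj
    have h := Finset.prod_induction (s := Polynomial.nthRootsFinset e (1 : ℂ))
      (fun z => (Polynomial.X - Polynomial.C z : Polynomial ℂ))
      (fun q => Function.Injective (Polynomial.aeval r q))
      (fun p q hp hq => by
        rw [map_mul]
        exact hp.comp hq)
      (by rw [map_one]; exact Function.injective_id) hinj
    rw [← hprod] at h
    obtain ⟨u, hu⟩ := exists_ne (0 : T)
    exact hu (h rfl)
  obtain ⟨z, hz, hinj⟩ := hex
  rw [← LinearMap.ker_eq_bot, Submodule.eq_bot_iff] at hinj
  push Not at hinj
  obtain ⟨w, hw, hw0⟩ := hinj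
  have hz1 := (Polynomial.mem_nthRootsFinset he (1 : ℂ)).1 hz
  have : NeZero e := ⟨by omega⟩
  obtain ⟨i, -, rfl⟩ := (eps_primitive he).eq_pow_of_pow_eq_one hz1
  refine ⟨i, w, hw0, ?_⟩
  rw [LinearMap.mem_ker, map_sub, Polynomial.aeval_X, Polynomial.aeval_C, LinearMap.sub_apply,
    sub_eq_zero, Module.algebraMap_end_apply] at hw
  rw [hw, zpow_natCast]

/-- The dihedral relation, from which the reflection of an eigenvector of the rotation has the
inverse eigenvalue. -/
lemma rot_mul_swap_mul_rot (e : ℕ) : rot e * swap * rot e = swap := by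
  refine Units.ext ?_
  ext i j
  fin_cases i <;> fin_cases j <;> simp [rot, swap, Matrix.mul_apply, eps_ne_zero]

/-- The linear map `B → T` given by an eigenvector `w` of the rotation and two coefficients. -/
def coeffMap {T : Type*} [AddCommGroup T] [Module ℂ T] (a b : ℕ) (w w' : T) : Poly 2 →ₗ[ℂ] T :=
  (co a b).smulRight w + (co b a).smulRight w'

lemma coeffMap_apply {T : Type*} [AddCommGroup T] [Module ℂ T] (a b : ℕ) (w w' : T) (f : Poly 2) :
    coeffMap a b w w' f = co a b f • w + co b a f • w' := rfl

lemma lead_weight (he : 1 ≤ e) (c : Label e) : (e : ℤ) ∣ (lead c).1 - (lead c).2 - wt c :=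
  (gen_mem c).1 _ _ (by rw [co_lead_gen he]; exact one_ne_zero)

lemma exists_equiv_irrRep (he : 1 ≤ e) {T : Type} [AddCommGroup T] [Module ℂ T]
    (τ : Representation ℂ (dihedral e) T) (hτ : τ.IsIrreducible) :
    ∃ c : IrrLabel e, Nonempty (τ.Equiv (irrRep he c.1).toRepresentation) := by
  have hT : Nontrivial T := by
    by_contra h
    rw [not_nontrivial_iff_subsingleton] at h
    exact bot_ne_top (α := Subrepresentation τ) (Subrepresentation.toSubmodule_injective
      (Subsingleton.elim _ _))
  obtain ⟨i, w, hw0, hw⟩ := exists_eigenvector he τ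
  set w' := τ ⟨swap, swap_mem e⟩ w with hw'
  have hww : τ ⟨swap, swap_mem e⟩ w' = w := by
    rw [hw', ← Module.End.mul_apply, ← map_mul,
      show (⟨swap, swap_mem e⟩ * ⟨swap, swap_mem e⟩ : dihedral e) = 1 from
        Subtype.ext swap_mul_swap, map_one, Module.End.one_apply]
  have hrw : τ ⟨rot e, rot_mem e⟩ w' = eps e ^ (-i) • w' := by
    have h1 : τ ⟨rot e, rot_mem e⟩ (τ ⟨swap, swap_mem e⟩ (τ ⟨rot e, rot_mem e⟩ w)) = w' := by
      rw [hw', ← Module.End.mul_apply, ← Module.End.mul_apply, ← map_mul, ← map_mul,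
        show (⟨rot e, rot_mem e⟩ * ⟨swap, swap_mem e⟩ * ⟨rot e, rot_mem e⟩ : dihedral e) =
          ⟨swap, swap_mem e⟩ from Subtype.ext (rot_mul_swap_mul_rot e)]
    rw [hw, map_smul, map_smul] at h1
    nth_rewrite 2 [← h1]
    rw [smul_smul, ← zpow_add₀ (eps_ne_zero e), neg_add_cancel, zpow_zero, one_smul]
  -- The coefficient map is equivariant because the coefficients transform like `w` and `w'`. Once
  -- it is nonzero on `gen c`, Schur's lemma makes its restriction an isomorphism.
  have key : ∀ c : Label e, (e : ℤ) ∣ i - wt c →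
      coeffMap (lead c).1 (lead c).2 w w' (gen c) ≠ 0 →
      ∃ c : IrrLabel e, Nonempty (τ.Equiv (irrRep he c.1).toRepresentation) := by
    intro c hc hne
    set Ψ := coeffMap (lead c).1 (lead c).2 w w' with hΨ
    have hd : (e : ℤ) ∣ (lead c).1 - (lead c).2 - i := by
      rw [show ((lead c).1 : ℤ) - (lead c).2 - i = (lead c).1 - (lead c).2 - wt c - (i - wt c)
        by ring]
      exact dvd_sub (lead_weight he c) hc
    have hd1 : eps e ^ (((lead c).1 : ℤ) - (lead c).2) = eps e ^ i := (eps_zpow_eq he).2 hd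
    have hd2 : eps e ^ (((lead c).2 : ℤ) - (lead c).1) = eps e ^ (-i) := by
      rw [zpow_neg, ← hd1, ← zpow_neg, neg_sub]
    have hr : ∀ f, Ψ (rotEnd e f) = τ ⟨rot e, rot_mem e⟩ (Ψ f) := by
      intro f
      rw [hΨ, coeffMap_apply, coeffMap_apply, co_rotEnd, co_rotEnd, hd1, hd2, map_add, map_smul,
        map_smul, hw, hrw, smul_smul, smul_smul, mul_comm, mul_comm (eps e ^ (-i))]
    have hs : ∀ f, Ψ (swapEnd f) = τ ⟨swap, swap_mem e⟩ (Ψ f) := by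
      intro f
      rw [hΨ, coeffMap_apply, coeffMap_apply, co_swapEnd, co_swapEnd, map_add, map_smul,
        map_smul, hww, add_comm]
    obtain ⟨d, hgd⟩ := exists_irrLabel c
    refine ⟨d, ?_⟩
    let φ : (irrRep he d.1).toSubmodule →ₗ[ℂ] T := Ψ.comp
      ((annRep (dihedral e)).toSubmodule.subtype.comp (irrRep he d.1).toSubmodule.subtype)
    let θ : Representation.IntertwiningMap (irrRep he d.1).toRepresentation τ :=
      φ.intertwiningMap_of_isIntertwiningMap _ _
        (intertwining_of_generators φ (fun v => hr v.1.1) (fun v => hs v.1.1))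
    have := irrRep_isIrreducible he d.1
    rcases Representation.IsIrreducible.bijective_or_eq_zero (k := ℂ)
      (V := (irrRep he d.1).toSubmodule) (W := T) θ with hb | h0
    · exact ⟨(θ.ofBijective hb).symm⟩
    · refine absurd ?_ hne
      exact congrArg (fun θ : Representation.IntertwiningMap _ τ => θ (toIrrRep he (gen c) hgd)) h0
  rcases exists_label_of_weight he i with ⟨c, c', hs, hs', hc, hc'⟩ | ⟨c, hs, hc⟩
  · have hgen : ∀ d : Label e, sg d ≠ 0 →
        coeffMap (lead d).1 (lead d).2 w w' (gen d) = w + sg d • w' := by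
      intro d hd
      rw [coeffMap_apply, co_swap_of_mem (gen_mem d) hd (lead d).1 (lead d).2, co_lead_gen he,
        one_smul, mul_one]
    -- The vectors `w + w'` and `w - w'` do not both vanish, which decides the sign of the label.
    by_cases h : w + w' = 0
    · refine key c' (by rwa [hc']) ?_
      rw [hgen c' (by rw [hs']; norm_num), hs']
      intro h'
      refine hw0 ?_
      have h2 : (2 : ℂ) • w = (w + w') + (w + (-1 : ℂ) • w') := by module
      rw [h, h', add_zero] at h2
      exact (smul_eq_zero.1 h2).resolve_left two_ne_zero
    · refine key c hc ?_
      rwa [hgen c (by rw [hs]; norm_num), hs, one_smul]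
  · refine key c hc ?_
    rwa [coeffMap_apply, co_swap_eq_zero (gen_mem c) hs (lead_weight he c), co_lead_gen he,
      one_smul, zero_smul, add_zero]

lemma isGelfandModel_annRep (he : 1 ≤ e) :
    IsGelfandModel (annRep (dihedral e)).toRepresentation :=
  ⟨IrrLabel e, fun c => irrRep he c.1, ⟨iSupIndep_irrRep he, iSup_irrRep he⟩,
    fun c => irrRep_isIrreducible he c.1, fun _ _ ⟨θ⟩ => irrRep_not_equiv he θ,
    fun _ _ _ τ hτ => exists_equiv_irrRep he τ hτ⟩

end InvDiff

end

theorem proposition6p4 (e : ℕ) (he : 1 ≤ e) :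
    -- the invariant ring
    InvDiff.A₂ e = Algebra.adjoin ℂ
      {InvDiff.x₁ ^ e + InvDiff.x₂ ^ e, InvDiff.x₁ * InvDiff.x₂} ∧
    -- the description of the modules over the invariant ring
    (∀ c : InvDiff.Label e,
      InvDiff.asInvModule (InvDiff.dihedral e) (InvDiff.M c) =
        Submodule.span (InvDiff.A₂ e) (InvDiff.genA c)) ∧
    -- (1)
    (∃ b : Module.Basis (InvDiff.BasisIndex e) (InvDiff.A₂ e) (InvDiff.Poly 2),
      ∀ k, b k = InvDiff.basisElt k) ∧
    -- (2)
    ((∀ c : InvDiff.Label e, IsSimpleModule (InvDiff.D₂ e) (InvDiff.M c)) ∧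
      iSupIndep (fun c : InvDiff.Label e => InvDiff.M c) ∧
      ⨆ c : InvDiff.Label e, InvDiff.M c = ⊤) ∧
    -- (3), isomorphisms
    ((∀ (i : ℕ) (hi : 1 ≤ i) (hie : 2 * i < e),
        Nonempty (InvDiff.M (.pow₁ i hi hie) ≃ₗ[InvDiff.D₂ e] InvDiff.M (.pow₂ i hi hie))) ∧
      (∀ c c' : InvDiff.Label e, Nonempty (InvDiff.M c ≃ₗ[InvDiff.D₂ e] InvDiff.M c') →
        c = c' ∨ ∃ (i : ℕ) (hi : 1 ≤ i) (hie : 2 * i < e),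
          (c = .pow₁ i hi hie ∧ c' = .pow₂ i hi hie) ∨
          (c = .pow₂ i hi hie ∧ c' = .pow₁ i hi hie))) ∧
    -- (3), ranks
    ((∀ (i : ℕ) (hi : 1 ≤ i) (hie : 2 * i < e),
        InvDiff.rankA (InvDiff.M (.pow₁ i hi hie)) = 2 ∧
        InvDiff.rankA (InvDiff.M (.pow₂ i hi hie)) = 2) ∧
      (Odd e → ∀ N : Submodule (InvDiff.D₂ e) (InvDiff.Poly 2),
        InvDiff.rankA N = 1 ↔ N = InvDiff.M .zero ∨ N = InvDiff.M .jac) ∧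
      (∀ (e₁ : ℕ) (he₁ : e = 2 * e₁) (N : Submodule (InvDiff.D₂ e) (InvDiff.Poly 2)),
        InvDiff.rankA N = 1 ↔ N = InvDiff.M .zero ∨ N = InvDiff.M .jac ∨
          N = InvDiff.M (.I e₁ he₁) ∨ N = InvDiff.M (.II e₁ he₁))) ∧
    -- (4)
    ((∀ c : InvDiff.Label e,
        (InvDiff.ann (InvDiff.dihedral e) (InvDiff.M c) : Set (InvDiff.Poly 2)) =
          Submodule.span ℂ {InvDiff.gen c}) ∧
      (∀ c : InvDiff.Label e,
        IsSimpleModule (InvDiff.D₂zero e) (InvDiff.ann (InvDiff.dihedral e) (InvDiff.M c))) ∧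
      iSupIndep (fun c : InvDiff.Label e => InvDiff.ann (InvDiff.dihedral e) (InvDiff.M c)) ∧
      ⨆ c : InvDiff.Label e, InvDiff.ann (InvDiff.dihedral e) (InvDiff.M c) =
        InvDiff.ann (InvDiff.dihedral e) ⊤) ∧
    -- the lowest weight space of `B` is a Gelfand model
    InvDiff.IsGelfandModel (InvDiff.annRep (InvDiff.dihedral e)).toRepresentation := by
  refine ⟨InvDiff.inv_eq_basicInv he, InvDiff.asInvModule_M he, InvDiff.exists_basis he,
    ⟨InvDiff.isSimpleModule_M he, InvDiff.iSupIndep_M he, InvDiff.iSup_M he⟩,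
    ⟨fun i hi hie => ⟨InvDiff.swapEquiv he (.pow₁ i hi hie)⟩, ?_⟩,
    ⟨fun i hi hie => ⟨InvDiff.rankA_M_of_sg_eq_zero he rfl, InvDiff.rankA_M_of_sg_eq_zero he rfl⟩,
      ?_, ?_⟩,
    ⟨InvDiff.coe_ann_M he, InvDiff.isSimpleModule_ann he, InvDiff.iSupIndep_ann he,
      InvDiff.iSup_ann he⟩,
    InvDiff.isGelfandModel_annRep he⟩
  · rintro c c' ⟨θ⟩
    rcases InvDiff.eq_or_eq_flip_of_equiv he θ with rfl | rfl
    · exact Or.inl rfl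
    · cases c with
      | pow₁ i hi hie => exact Or.inr ⟨i, hi, hie, Or.inl ⟨rfl, rfl⟩⟩
      | pow₂ i hi hie => exact Or.inr ⟨i, hi, hie, Or.inr ⟨rfl, rfl⟩⟩
      | _ => exact Or.inl rfl
  · intro hodd N
    rw [InvDiff.rankA_eq_one_iff he]
    constructor
    · rintro ⟨c, hc, rfl⟩
      cases c with
      | zero => exact Or.inl rfl
      | jac => exact Or.inr rfl
      | pow₁ i hi hie => exact absurd rfl hc
      | pow₂ i hi hie => exact absurd rfl hc
      | I e₁ h => exact absurd (h ▸ even_two_mul e₁) (Nat.not_even_iff_odd.2 hodd)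
      | II e₁ h => exact absurd (h ▸ even_two_mul e₁) (Nat.not_even_iff_odd.2 hodd)
    · rintro (rfl | rfl)
      · exact ⟨.zero, by simp [InvDiff.sg], rfl⟩
      · exact ⟨.jac, by simp [InvDiff.sg], rfl⟩
  · intro e₁ he₁ N
    rw [InvDiff.rankA_eq_one_iff he]
    constructor
    · rintro ⟨c, hc, rfl⟩
      cases c with
      | zero => exact Or.inl rfl
      | jac => exact Or.inr (Or.inl rfl)
      | pow₁ i hi hie => exact absurd rfl hc
      | pow₂ i hi hie => exact absurd rfl hc
      | I e₂ h =>
        obtain rfl : e₂ = e₁ := by omega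
        exact Or.inr (Or.inr (Or.inl rfl))
      | II e₂ h =>
        obtain rfl : e₂ = e₁ := by omega
        exact Or.inr (Or.inr (Or.inr rfl))
    · rintro (rfl | rfl | rfl | rfl)
      · exact ⟨.zero, by simp [InvDiff.sg], rfl⟩
      · exact ⟨.jac, by simp [InvDiff.sg], rfl⟩
      · exact ⟨.I e₁ he₁, by simp [InvDiff.sg], rfl⟩
      · exact ⟨.II e₁ he₁, by simp [InvDiff.sg], rfl⟩
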